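/- Let $d,n\ge 1$ be integers and $\sigma>-1$ a real number, and put $\lambda=d+1+\sigma$. Let $\langle z,w\rangle=\sum_j z_j\overline{w_j}$ and $|z|=\sqrt{\langle z,z\rangle}$ on $\mathbf C^d$, let $B=\{z\in\mathbf C^d:|z|<1\}$, and let $dv$ be Lebesgue measure normalized so that $v(B)=1$. For $G\in L^\infty(B)$ let $$T_\sigma G(z)=c_\sigma\int_B\frac{(1-|w|^2)^\sigma}{(1-\langle z,w\rangle)^{d+1+\sigma}}\,G(w)\,dv(w),\qquad z\in B,$$ be the weighted Bergman projection, where the power is the principal branch and $c_\sigma$ is chosen so that $c_\sigma\int_B(1-|w|^2)^\sigma dv(w)=1$. Let $\mathcal B$ be the Bloch space of all analytic functions $f$ on $B$ for which $\sup_{z\in B}(1-|z|^2)|\nabla f(z)|<\infty$, where $\nabla f=(\partial f/\partial z_1,\dots,\partial f/\partial z_d)$. Let $\tilde d=\binom{n+d-1}{d-1}$ be the number of multi-indices $\alpha\in\mathbf Z_+^d$ with $|\alpha|=n$, and let $|\cdot|_{\mathbf C^{\tilde d}}$ be any norm on $\mathbf C^{\tilde d}$ (with coordinates indexed by these $\alpha$)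 such that $|\overline Z|_{\mathbf C^{\tilde d}}=|Z|_{\mathbf C^{\tilde d}}$ for all $Z$, where the bar denotes coordinatewise conjugation. For $f$ analytic on $B$ set $$\mathcal D_zf(z)=(\partial^\alpha f(z))_{|\alpha|=n},\qquad \|f\|_{\mathcal B}=\sup_{z\in B}(1-|z|^2)^n\,|\mathcal D_zf(z)|_{\mathbf C^{\tilde d}},$$ and for $\zeta\in\mathbf C^d$ set $Z(\zeta)=(\zeta^\alpha)_{|\alpha|=n}\in\mathbf C^{\tilde d}$. **Theorem.** For every $G\in L^\infty(B)$ the integral defining $T_\sigma G(z)$ converges absolutely for every $z\in B$ and $T_\sigma G\in\mathcal B$. The maximum $\mathcal C=\max_{|\zeta|=1}|Z(\zeta)|_{\mathbf C^{\tilde d}}$ exists, and the operator norm $\|T_\sigma\|_{L^\infty(B)\to\mathcal B}$, i.e. the least $M\ge 0$ with $\|T_\sigma G\|_{\mathcal B}\le M\|G\|_\infty$ for all $G\in L^\infty(B)$, satisfies $$\|T_\sigma\|_{L^\infty(B)\to\mathcal B}=\sup_{\|G\|_\infty\le 1}\|T_\sigma G\|_{\mathcal B}=\mathcal C\,\frac{\Gamma(\lambda+n)\,\Gamma(n)}{\Gamma^2((\lambda+n)/2)}.$$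 -/

import Mathlib

open MeasureTheory
open scoped ENNReal

noncomputable section

namespace BergmanBloch

/-- The space `ℂ^d` with the norm of the inner product `⟨z, w⟩ = ∑ j, z_j * conj (w_j)`.
In Mathlib's notation `⟨z, w⟩ = inner ℂ w z`. -/
abbrev Cd (d : ℕ) : Type := EuclideanSpace ℂ (Fin d)

/-- The open unit ball `B` of `ℂ^d`. -/
abbrev unitBall (d : ℕ) : Set (Cd d) := Metric.ball 0 1

/-- The Lebesgue measure `dv` on `B`, normalized so that `v(B) = 1`. -/
def ballMeasure (d : ℕ) : Measure (Cd d) :=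
  (volume (unitBall d))⁻¹ • volume.restrict (unitBall d)

/-- The normalizing constant `c_σ`: the number for which the measure
`dv_σ(w) = c_σ (1 - |w|²)^σ dv(w)` has total mass `1`. -/
def normConst (d : ℕ) (σ : ℝ) : ℝ :=
  (∫ w, (1 - ‖w‖ ^ 2) ^ σ ∂(ballMeasure d))⁻¹

/-- The kernel `K_σ(z, w) = (1 - |w|²)^σ / (1 - ⟨z, w⟩)^(d + 1 + σ)` (principal branch). -/
def kernel {d : ℕ} (σ : ℝ) (z w : Cd d) : ℂ :=
  (((1 - ‖w‖ ^ 2) ^ σ : ℝ) : ℂ) / (1 - inner ℂ w z) ^ (((d : ℝ) + 1 + σ : ℝ) : ℂ)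

/-- The weighted Bergman projection `T_σ G(z) = c_σ ∫_B K_σ(z, w) G(w) dv(w)`. -/
def bergmanProj {d : ℕ} (σ : ℝ) (G : Cd d → ℂ) (z : Cd d) : ℂ :=
  (normConst d σ : ℂ) * ∫ w, kernel σ z w * G w ∂(ballMeasure d)

/-- The complex partial derivative `∂f/∂z_j`, as a function of the point. -/
def partialDeriv {d : ℕ} (j : Fin d) (f : Cd d → ℂ) (z : Cd d) : ℂ :=
  lineDeriv ℂ f z (EuclideanSpace.single j 1)

/-- The Bloch space `𝓑`: the analytic functions `f` on `B` for which
`sup_{z ∈ B} (1 - |z|²) |∇f(z)|` is finite, `∇f = (∂f/∂z_1, …, ∂f/∂z_d)`. -/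
def blochSpace (d : ℕ) : Set (Cd d → ℂ) :=
  {f | AnalyticOnNhd ℂ f (unitBall d) ∧
    ∃ M : ℝ, ∀ z ∈ unitBall d,
      (1 - ‖z‖ ^ 2) * ‖(WithLp.toLp 2 fun j => partialDeriv j f z : Cd d)‖ ≤ M}

/-- The multi-indices `α ∈ ℤ₊^d` with `|α| = n`; there are `(n+d-1).choose (d-1)` of them. -/
abbrev MultiIndex (d n : ℕ) : Type := {α : Fin d → ℕ // ∑ j, α j = n}

/-- `∂^α f = ∂_1^(α_1) ⋯ ∂_d^(α_d) f`. -/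
def mixedPartial {d : ℕ} (α : Fin d → ℕ) (f : Cd d → ℂ) : Cd d → ℂ :=
  (List.finRange d).foldr (fun j g => (partialDeriv j)^[α j] g) f

/-- `𝓓_z f(z) = (∂^α f(z))_{|α| = n}`. -/
def derivVector {d : ℕ} (n : ℕ) (f : Cd d → ℂ) (z : Cd d) : MultiIndex d n → ℂ :=
  fun α => mixedPartial α.1 f z

/-- `Z(ζ) = (ζ^α)_{|α| = n}`. -/
def monomialVector {d : ℕ} (n : ℕ) (ζ : Cd d) : MultiIndex d n → ℂ :=
  fun α => ∏ j, ζ j ^ α.1 j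

/-- The Bloch semi-norm `sup_{z ∈ B} (1 - |z|²)^n |𝓓_z f(z)|` (possibly `∞`) given by a
norm `N` on the coordinate space of the multi-indices of length `n`. -/
def blochSeminorm {d n : ℕ} (N : Seminorm ℂ (MultiIndex d n → ℂ)) (f : Cd d → ℂ) : ℝ≥0∞ :=
  ⨆ z ∈ unitBall d, ENNReal.ofReal ((1 - ‖z‖ ^ 2) ^ n * N (derivVector n f z))

/-- The operator norm of `T_σ : L^∞(B) → 𝓑`: the infimum of the `M ∈ [0, ∞]` such that
`‖T_σ G‖_𝓑 ≤ M ‖G‖_∞` for every `G ∈ L^∞(B)`. -/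
def bergmanOpNorm {d n : ℕ} (σ : ℝ) (N : Seminorm ℂ (MultiIndex d n → ℂ)) : ℝ≥0∞ :=
  sInf {M | ∀ G : Lp ℂ ∞ (ballMeasure d), blochSeminorm N (bergmanProj σ G) ≤ M * ‖G‖ₑ}

/-- The number `𝓒 = sup_{|ζ| = 1} |Z(ζ)|`. -/
def extremalConst {d n : ℕ} (N : Seminorm ℂ (MultiIndex d n → ℂ)) : ℝ :=
  sSup ((fun ζ : Cd d => N (monomialVector n ζ)) '' Metric.sphere 0 1)

end BergmanBloch

end

open BergmanBloch

/-! Write λ = d + 1 + σ and dv_σ for the weighted probability measure on the ball. Differentiating n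
times under the integral turns the kernel (1 - ⟨z, w⟩)^(-λ) into (λ)_n conj(w^α) (1 - ⟨z, w⟩)^(-λ-n)
(`mixedPartial_kernelIntegral`). The triangle inequality for integrals (`seminorm_integral_le`),
invariance under conjugation and |Z(w)| ≤ 𝓒 on the ball then reduce the upper bound to J_s(z) = ∫ |1
- ⟨z, w⟩|^(-λ-s) dv_σ(w) with s = n.

Expanding (1 - u)^(-(λ+s)/2) at u = ⟨z, w⟩, whose powers are orthogonal with explicit norms,
identifies J_s(z) with ₂F₁((λ+s)/2, (λ+s)/2; λ; |z|²) (`hasSum_integral_kernel`). The ratios of its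
coefficients to those of (1 - x)^(-s) increase to Γ(λ)Γ(s)/Γ((λ+s)/2)². Hence (1 - |z|²)^s J_s(z) is
at most this number and tends to it as |z| → 1. Since (λ)_n Γ(λ) = Γ(λ+n), the stated constant
appears.

For sharpness (`le_iSup_blochSeminorm`), take ζ maximizing |Z(ζ)|, z = rζ, and G the phase that
makes the kernel of exponent -(λ+n) positive. Replacing Z(w) by Z(ζ) costs O(|1 - ⟨z, w⟩|^(1/2)), so
the error is a multiple of J_{n-1/2}(z), which the factor (1 - r²)^n sends to 0 as r → 1. -/

namespace BergmanBloch

/-! ### Binomial series and the boundary behaviour of the hypergeometric series -/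

open Filter Topology Finset

/-- The rising factorial `(a)_k = a (a + 1) ⋯ (a + k - 1)`. -/
noncomputable def rising (a : ℝ) (k : ℕ) : ℝ := ∏ j ∈ range k, (a + j)

lemma rising_zero (a : ℝ) : rising a 0 = 1 := by simp [rising]

lemma rising_succ (a : ℝ) (k : ℕ) : rising a (k + 1) = rising a k * (a + k) := by
  simp [rising, prod_range_succ]

lemma rising_pos {a : ℝ} (ha : 0 < a) (k : ℕ) : 0 < rising a k :=
  prod_pos fun j _ => by positivity

lemma Gamma_add_nat {a : ℝ} (ha : 0 < a) (k : ℕ) :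
    Real.Gamma (a + k) = rising a k * Real.Gamma a := by
  induction k with
  | zero => simp [rising]
  | succ k ih =>
    rw [rising_succ, Nat.cast_succ, ← add_assoc, Real.Gamma_add_one (by positivity), ih]
    ring

lemma choose_eq_rising (a : ℝ) (k : ℕ) :
    Ring.choose (a + k - 1) k = rising a k / k.factorial := by
  have h := Ring.factorial_nsmul_multichoose_eq_ascPochhammer a k
  have h2 : (ascPochhammer ℕ k).smeval a = rising a k := by
    induction k with
    | zero => simp [rising]
    | succ k ih =>
      rw [ascPochhammer_succ_right, Polynomial.smeval_mul, ih
        (Ring.factorial_nsmul_multichoose_eq_ascPochhammer a k), rising_succ]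
      simp [Polynomial.smeval_add, Polynomial.smeval_natCast]
  rw [h2, nsmul_eq_mul] at h
  rw [Ring.choose, show a + k - 1 - k + 1 = a by ring, ← h]
  field_simp

lemma hasSum_one_sub_cpow (a : ℝ) {u : ℂ} (hu : ‖u‖ < 1) :
    HasSum (fun k : ℕ => ((rising a k / k.factorial : ℝ) : ℂ) * u ^ k)
      ((1 - u) ^ (-(a : ℂ))) := by
  have h := (Complex.one_div_one_sub_cpow_hasFPowerSeriesOnBall_zero (a : ℂ)).hasSum
    (y := u) (by simpa [← ofReal_norm, enorm_eq_nnnorm] using hu)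
  simp only [zero_add, one_div, FormalMultilinearSeries.ofScalars_apply_eq, smul_eq_mul] at h
  rw [Complex.cpow_neg]
  have e : ∀ k : ℕ, ((rising a k / k.factorial : ℝ) : ℂ) = Ring.choose ((a : ℂ) + k - 1) k := by
    intro k
    rw [← choose_eq_rising, Complex.ofReal_choose]
    push_cast; rfl
  simpa only [e] using h

lemma hasSum_one_sub_rpow (a : ℝ) {x : ℝ} (hx0 : 0 ≤ x) (hx : x < 1) :
    HasSum (fun k : ℕ => rising a k / k.factorial * x ^ k) ((1 - x) ^ (-a)) := by
  have h := hasSum_one_sub_cpow a (u := x) (by simpa [abs_of_nonneg hx0] using hx)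
  rw [← Complex.hasSum_ofReal]
  convert h using 2
  · push_cast; rfl
  · rw [Complex.ofReal_cpow (by linarith)]; push_cast; rfl

/-- The ratio of the Taylor coefficients of `₂F₁((l+s)/2, (l+s)/2; l; x)` and `(1 - x)^(-s)`. -/
noncomputable def coeffRatio (l s : ℝ) (k : ℕ) : ℝ :=
  rising ((l + s) / 2) k ^ 2 / (rising l k * rising s k)

lemma coeffRatio_nonneg {l s : ℝ} (hl : 0 < l) (hs : 0 < s) (k : ℕ) : 0 ≤ coeffRatio l s k := by
  have := rising_pos hl k
  have := rising_pos hs k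
  unfold coeffRatio; positivity

/-- Consecutive ratios have quotient ((l+s)/2 + k)² / ((l+k)(s+k)), which is at least 1 by the
inequality of arithmetic and geometric means. -/
lemma coeffRatio_monotone {l s : ℝ} (hl : 0 < l) (hs : 0 < s) : Monotone (coeffRatio l s) := by
  refine monotone_nat_of_le_succ fun k => ?_
  have h1 := rising_pos hl k
  have h2 := rising_pos hs k
  have h3 := rising_pos (a := (l + s) / 2) (by positivity) k
  have hk : (0 : ℝ) ≤ k := k.cast_nonneg
  have h4 : (l + k) * (s + k) ≤ ((l + s) / 2 + k) ^ 2 := by nlinarith [sq_nonneg (l - s)]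
  unfold coeffRatio
  rw [rising_succ, rising_succ, rising_succ, div_le_div_iff₀ (by positivity) (by positivity)]
  nlinarith [mul_le_mul_of_nonneg_left h4
    (show 0 ≤ rising ((l + s) / 2) k ^ 2 * (rising l k * rising s k) by positivity)]

/-- The limit of `coeffRatio`. -/
noncomputable def gammaRatio (l s : ℝ) : ℝ :=
  Real.Gamma l * Real.Gamma s / Real.Gamma ((l + s) / 2) ^ 2

lemma coeffRatio_tendsto {l s : ℝ} (hl : 0 < l) (hs : 0 < s) :
    Tendsto (coeffRatio l s) atTop (𝓝 (gammaRatio l s)) := by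
  have ha : 0 < (l + s) / 2 := by positivity
  -- The Euler sequence `Real.GammaSeq` at k has k + 1 factors in its denominator, so it matches the
  -- ratio at index k + 1. The powers of k and the factorials cancel because l + s = 2 · (l+s)/2.
  rw [← tendsto_add_atTop_iff_nat 1]
  have h := ((Real.GammaSeq_tendsto_Gamma l).mul (Real.GammaSeq_tendsto_Gamma s)).div
    ((Real.GammaSeq_tendsto_Gamma ((l + s) / 2)).pow 2)
    (pow_ne_zero 2 (Real.Gamma_pos_of_pos ha).ne')
  refine h.congr' ?_
  filter_upwards [eventually_gt_atTop 0] with k hk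
  have h1 := (rising_pos hl (k + 1)).ne'
  have h2 := (rising_pos hs (k + 1)).ne'
  have h3 := (rising_pos ha (k + 1)).ne'
  have hk' : (0 : ℝ) < k := by exact_mod_cast hk
  have h5 : ((k : ℝ) ^ ((l + s) / 2)) ^ 2 = (k : ℝ) ^ l * (k : ℝ) ^ s := by
    rw [sq, ← Real.rpow_add hk', ← Real.rpow_add hk']; congr 1; ring
  have h6 := (Real.rpow_pos_of_pos hk' l).ne'
  have h7 := (Real.rpow_pos_of_pos hk' s).ne'
  have h8 := (Real.rpow_pos_of_pos hk' ((l + s) / 2)).ne'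
  have h9 : ((k.factorial : ℕ) : ℝ) ≠ 0 := by positivity
  simp only [Pi.div_apply, Real.GammaSeq, coeffRatio]
  change _ * _ / rising l (k + 1) * (_ / rising s (k + 1)) /
    (_ / rising ((l + s) / 2) (k + 1)) ^ 2 = _
  rw [div_pow, mul_pow, h5]
  field_simp

lemma coeffRatio_le {l s : ℝ} (hl : 0 < l) (hs : 0 < s) (k : ℕ) :
    coeffRatio l s k ≤ gammaRatio l s :=
  (coeffRatio_monotone hl hs).ge_of_tendsto (coeffRatio_tendsto hl hs) k

/-- The Taylor coefficients of `₂F₁((l+s)/2, (l+s)/2; l; x)`. -/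
noncomputable def hypCoeff (l s : ℝ) (k : ℕ) : ℝ :=
  rising ((l + s) / 2) k ^ 2 / (k.factorial * rising l k)

lemma hypCoeff_eq {l s : ℝ} (hl : 0 < l) (hs : 0 < s) (k : ℕ) :
    hypCoeff l s k = coeffRatio l s k * (rising s k / k.factorial) := by
  have h1 := (rising_pos hl k).ne'
  have h2 := (rising_pos hs k).ne'
  have h9 : ((k.factorial : ℕ) : ℝ) ≠ 0 := by positivity
  unfold hypCoeff coeffRatio
  field_simp

lemma hasSum_hypCoeff_le {l s x F : ℝ} (hl : 0 < l) (hs : 0 < s) (hx0 : 0 ≤ x) (hx : x < 1)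
    (h : HasSum (fun k => hypCoeff l s k * x ^ k) F) :
    F ≤ gammaRatio l s * (1 - x) ^ (-s) := by
  refine hasSum_le (fun k => ?_) h ((hasSum_one_sub_rpow s hx0 hx).mul_left _)
  have := rising_pos hs k
  rw [hypCoeff_eq hl hs, mul_assoc]
  exact mul_le_mul_of_nonneg_right (coeffRatio_le hl hs k) (by positivity)

/-- An Abelian argument: for large k the coefficients are nearly `gammaRatio l s` times those of (1
- x)^(-s), and finitely many terms are negligible against (1 - x)^(-s). -/
lemma tendsto_hypergeometric {l s : ℝ} (hl : 0 < l) (hs : 0 < s) {F : ℝ → ℝ}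
    (hF : ∀ x, 0 ≤ x → x < 1 → HasSum (fun k => hypCoeff l s k * x ^ k) (F x)) :
    Tendsto (fun x => (1 - x) ^ s * F x) (𝓝[<] 1) (𝓝 (gammaRatio l s)) := by
  have hIoo : ∀ᶠ x : ℝ in 𝓝[<] 1, x ∈ Set.Ico (0 : ℝ) 1 :=
    Ico_mem_nhdsLT (by norm_num)
  have hpow : Tendsto (fun x : ℝ => (1 - x) ^ s) (𝓝[<] 1) (𝓝 0) := by
    have : ContinuousAt (fun x : ℝ => (1 - x) ^ s) 1 :=
      (continuousAt_const.sub continuousAt_id).rpow_const (Or.inr hs.le)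
    have h := this.tendsto
    simp only [sub_self, Real.zero_rpow hs.ne'] at h
    exact h.mono_left nhdsWithin_le_nhds
  rw [Metric.tendsto_nhds]
  intro ε hε
  obtain ⟨K, hK⟩ := ((tendsto_order.1 (coeffRatio_tendsto hl hs)).1 (gammaRatio l s - ε / 2)
    (by linarith)).exists
  set q := coeffRatio l s
  set b : ℕ → ℝ := fun k => rising s k / k.factorial
  have hb : ∀ k, 0 ≤ b k := fun k => by have := rising_pos hs k; positivity
  set c : ℝ := ∑ k ∈ range K, q K * b k
  have hc : Tendsto (fun x : ℝ => (1 - x) ^ s * c) (𝓝[<] 1) (𝓝 0) := by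
    simpa using hpow.mul_const c
  filter_upwards [hIoo, (tendsto_order.1 hc).2 (ε / 2) (by positivity)] with x hx hxc
  have h1x : 0 < 1 - x := by linarith [hx.2]
  have hinv : (1 - x) ^ s * (1 - x) ^ (-s) = 1 := by
    rw [← Real.rpow_add h1x]; simp
  have hp : 0 < (1 - x) ^ s := Real.rpow_pos_of_pos h1x s
  have hup := hasSum_hypCoeff_le hl hs hx.1 hx.2 (hF x hx.1 hx.2)
  -- From index K on, monotonicity gives `q K ≤ q k`. The earlier terms may violate this, and
  -- subtracting `c` compensates for all of them at once since x^k ≤ 1.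
  have hlow : q K * (1 - x) ^ (-s) - c ≤ F x := by
    have h1 := (hasSum_one_sub_rpow s hx.1 hx.2).mul_left (q K)
    have h2 : HasSum (fun k => if k ∈ range K then q K * b k else 0) c := by
      have : c = ∑ k ∈ range K, if k ∈ range K then q K * b k else 0 :=
        sum_congr rfl fun k hk => by simp [hk]
      rw [this]
      exact hasSum_sum_of_ne_finset_zero fun k hk => by simp [hk]
    refine hasSum_le (fun k => ?_) (h1.sub h2) (hF x hx.1 hx.2)
    have hxk : 0 ≤ x ^ k := pow_nonneg hx.1 k
    have hxk1 : x ^ k ≤ 1 := pow_le_one₀ hx.1 hx.2.le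
    rw [hypCoeff_eq hl hs]
    change q K * (b k * x ^ k) - _ ≤ q k * b k * x ^ k
    have hq : ∀ k, 0 ≤ q k := coeffRatio_nonneg hl hs
    have hnn : 0 ≤ q k * b k * x ^ k := mul_nonneg (mul_nonneg (hq k) (hb k)) hxk
    split_ifs with hk
    · nlinarith [mul_nonneg (mul_nonneg (hq K) (hb k)) (sub_nonneg.2 hxk1)]
    · have : q K ≤ q k := coeffRatio_monotone hl hs (by simpa using hk)
      nlinarith [mul_nonneg (sub_nonneg.2 this) (mul_nonneg (hb k) hxk)]
  rw [Real.dist_eq, abs_lt]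
  have e1 := mul_le_mul_of_nonneg_left hup hp.le
  have e2 := mul_le_mul_of_nonneg_left hlow hp.le
  have e3 : (1 - x) ^ s * (gammaRatio l s * (1 - x) ^ (-s)) = gammaRatio l s := by
    rw [mul_left_comm, hinv, mul_one]
  have e4 : (1 - x) ^ s * (q K * (1 - x) ^ (-s) - c) = q K - (1 - x) ^ s * c := by
    rw [mul_sub, mul_left_comm, hinv, mul_one]
  constructor <;> linarith

end BergmanBloch

/-! ### Moments of ⟨ζ, w⟩ for radial weights -/

namespace BergmanBloch

open Filter Topology Finset

/-- In polar coordinates x = r s, homogeneity separates f(x) into r^m and its values on the sphere,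
so the integral is a product. -/
lemma integral_homogeneous_mul_radial {E : Type*} [NormedAddCommGroup E] [NormedSpace ℝ E]
    [MeasurableSpace E] [BorelSpace E] [FiniteDimensional ℝ E] [Nontrivial E] (μ : Measure E)
    [μ.IsAddHaarMeasure] {f : E → ℝ} {m : ℕ} (hf : ∀ r : ℝ, 0 < r → ∀ x, f (r • x) = r ^ m * f x)
    (g : ℝ → ℝ) :
    ∫ x, f x * g ‖x‖ ∂μ = (∫ s, f s ∂μ.toSphere) *
      ∫ r in Set.Ioi (0 : ℝ), r ^ (Module.finrank ℝ E - 1) * (r ^ m * g r) := by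
  calc
    ∫ x, f x * g ‖x‖ ∂μ = ∫ x : ({(0)}ᶜ : Set E), f x * g (‖x.1‖) ∂(μ.comap (↑)) := by
      rw [integral_subtype_comap (measurableSet_singleton _).compl fun x ↦ f x * g (‖x‖),
        restrict_compl_singleton]
    _ = ∫ x, f x.1 * (x.2.1 ^ m * g x.2)
          ∂μ.toSphere.prod (.volumeIoiPow (Module.finrank ℝ E - 1)) := by
      rw [← μ.measurePreserving_homeomorphUnitSphereProd.integral_comp
        (Homeomorph.measurableEmbedding _)]
      refine integral_congr_ae (.of_forall fun x => ?_)
      have hx : 0 < ‖x.1‖ := norm_pos_iff.2 x.2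
      have h := hf ‖x.1‖ hx (‖x.1‖⁻¹ • x.1)
      rw [smul_smul, mul_inv_cancel₀ hx.ne', one_smul] at h
      simp only [homeomorphUnitSphereProd_apply_snd_coe, homeomorphUnitSphereProd_apply_fst_coe]
      rw [h]; ring
    _ = (∫ s, f s ∂μ.toSphere) * ∫ x : Set.Ioi (0 : ℝ), x.1 ^ m * g x
          ∂.volumeIoiPow (Module.finrank ℝ E - 1) :=
      integral_prod_mul (fun s : Metric.sphere (0 : E) 1 => f s)
        (fun x : Set.Ioi (0 : ℝ) => x.1 ^ m * g x)
    _ = _ := by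
      congr 1
      simp only [Measure.volumeIoiPow, ENNReal.ofReal]
      rw [integral_withDensity_eq_integral_smul,
        integral_subtype_comap measurableSet_Ioi
          fun a ↦ Real.toNNReal (a ^ (Module.finrank ℝ E - 1)) • (a ^ m * g a),
        setIntegral_congr_fun measurableSet_Ioi fun x hx ↦ ?_]
      · rw [NNReal.smul_def, Real.coe_toNNReal _ (pow_nonneg (Set.mem_Ioi.1 hx).le _), smul_eq_mul]
      · exact (measurable_subtype_coe.pow_const _).real_toNNReal

lemma integral_pow_mul_comp_sq (j : ℕ) (g : ℝ → ℝ) :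
    ∫ r in Set.Ioi (0 : ℝ), r ^ (2 * j + 1) * g (r ^ 2) =
      1 / 2 * ∫ t in Set.Ioi (0 : ℝ), t ^ j * g t := by
  have h := integral_comp_rpow_Ioi (fun t => t ^ j * g t) (p := 2) (by norm_num)
  rw [← h, ← integral_const_mul]
  refine setIntegral_congr_fun measurableSet_Ioi fun r hr => ?_
  simp only [smul_eq_mul]
  norm_num
  ring

lemma integral_Ioi_beta (j : ℕ) {σ : ℝ} (hσ : -1 < σ) :
    ∫ t in Set.Ioi (0 : ℝ), t ^ j * (if t < 1 then (1 - t) ^ σ else 0) =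
      j.factorial * Real.Gamma (σ + 1) / Real.Gamma (j + 1 + (σ + 1)) := by
  have hj : (0 : ℝ) < j + 1 := by positivity
  have h1 := Complex.betaIntegral_eq_Gamma_mul_div ((j + 1 : ℝ) : ℂ) ((σ + 1 : ℝ) : ℂ)
    (by simpa using hj) (by simp; linarith)
  rw [← Complex.ofReal_add, Complex.Gamma_ofReal, Complex.Gamma_ofReal, Complex.Gamma_ofReal,
    ← Complex.ofReal_mul, ← Complex.ofReal_div, Real.Gamma_nat_eq_factorial] at h1
  rw [← Complex.ofReal_inj, ← h1, Complex.betaIntegral,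
    intervalIntegral.integral_of_le zero_le_one, ← integral_complex_ofReal,
    ← setIntegral_congr_set Ioo_ae_eq_Ioc]
  have h2 : ∀ t : ℝ, ((t ^ j * (if t < 1 then (1 - t) ^ σ else 0) : ℝ) : ℂ) =
      (Set.Iio (1 : ℝ)).indicator (fun t : ℝ => ((t ^ j * (1 - t) ^ σ : ℝ) : ℂ)) t := by
    intro t
    by_cases ht : t < 1 <;> simp [ht]
  simp_rw [h2]
  rw [setIntegral_indicator measurableSet_Iio, Set.Ioi_inter_Iio]
  refine setIntegral_congr_fun measurableSet_Ioo fun t ht => ?_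
  have : (((σ + 1 : ℝ) : ℂ) - 1) = (σ : ℂ) := by push_cast; ring
  have h3 : (((j + 1 : ℝ) : ℂ) - 1) = (j : ℂ) := by push_cast; ring
  rw [this, h3, Complex.cpow_natCast, Complex.ofReal_mul, Complex.ofReal_pow,
    Complex.ofReal_cpow (by linarith [ht.2])]
  push_cast; rfl

lemma integral_Ioi_exp (j : ℕ) :
    ∫ t in Set.Ioi (0 : ℝ), t ^ j * Real.exp (-t) = j.factorial := by
  rw [← Real.Gamma_nat_eq_factorial, Real.Gamma_eq_integral (by positivity)]
  refine setIntegral_congr_fun measurableSet_Ioi fun r hr => ?_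
  simp [mul_comm]

lemma finrank_Cd (d : ℕ) : Module.finrank ℝ (Cd d) = 2 * d := by
  rw [← Module.finrank_mul_finrank ℝ ℂ (Cd d)]
  simp

/-- The integral of `|⟨ζ, w⟩|^{2k}` against a radial weight. -/
lemma integral_inner_pow_mul_radial {d : ℕ} (hd : 1 ≤ d) (k : ℕ) (ζ : Cd d) :
    ∃ A : ℝ, ∀ g : ℝ → ℝ, ∫ w : Cd d, ‖inner ℂ w ζ‖ ^ (2 * k) * g (‖w‖ ^ 2) =
      A * ∫ t in Set.Ioi (0 : ℝ), t ^ (k + d - 1) * g t := by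
  have : Nontrivial (Cd d) := by
    apply Module.nontrivial_of_finrank_pos (R := ℝ)
    rw [finrank_Cd]; omega
  -- The factor 1/2 comes from the substitution t = r².
  refine ⟨(∫ s, ‖inner ℂ (s : Cd d) ζ‖ ^ (2 * k) ∂(volume : Measure (Cd d)).toSphere) * (1 / 2),
    fun g => ?_⟩
  have h := integral_homogeneous_mul_radial (volume : Measure (Cd d))
    (f := fun w => ‖inner ℂ w ζ‖ ^ (2 * k)) (m := 2 * k) (fun r hr x => by
      rw [← mul_pow]; congr 1
      rw [← Complex.coe_smul, inner_smul_left]; simp [abs_of_pos hr]) (fun r => g (r ^ 2))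
  rw [h, mul_assoc, finrank_Cd, ← integral_pow_mul_comp_sq]
  congr 1
  refine setIntegral_congr_fun measurableSet_Ioi fun r hr => ?_
  rw [← mul_assoc, ← pow_add]
  congr 2; omega

lemma integral_gaussian_basis {d : ℕ} (i₀ : Fin d) :
    ∃ c : ℝ, 0 < c ∧ ∀ k : ℕ, ∫ w : Cd d, ‖w i₀‖ ^ (2 * k) * Real.exp (-‖w‖ ^ 2) =
      c * k.factorial := by
  let e := PiLp.continuousLinearEquiv 2 ℝ (fun _ : Fin d => ℂ) |>.symm
  -- Haar measures are proportional. The factor need not be identified: it does not depend on k and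
  -- cancels when the measure is normalized.
  have he : (volume : Measure (Cd d)) = _ • Measure.map e volume :=
    Measure.isAddLeftInvariant_eq_smul _ _
  set c := Measure.addHaarScalarFactor (volume : Measure (Cd d)) (Measure.map e volume)
  have hm : MeasurableEmbedding e := e.toHomeomorph.measurableEmbedding
  have hc : 0 < c := Measure.addHaarScalarFactor_pos_of_isAddHaarMeasure _ _
  refine ⟨c * Real.pi ^ d, by positivity, fun k => ?_⟩
  rw [he, integral_smul_nnreal_measure, NNReal.smul_def, smul_eq_mul, mul_assoc,
    hm.integral_map]
  congr 1
  -- The exponent is spread over all coordinates, zero away from `i₀`, so that the integral factors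
  -- into planar Gaussian integrals.
  have h1 : ∀ x : Fin d → ℂ, ‖(e x) i₀‖ ^ (2 * k) * Real.exp (-‖e x‖ ^ 2) =
      ∏ i, (‖x i‖ ^ (2 * (if i = i₀ then k else 0)) * Real.exp (-‖x i‖ ^ 2)) := by
    intro x
    rw [EuclideanSpace.norm_sq_eq, ← sum_neg_distrib, Real.exp_sum, prod_mul_distrib]
    congr 1
    rw [prod_eq_single i₀]
    · simp; rfl
    · intro i _ hi; simp [hi]
    · simp
  have h2 : ∀ k : ℕ, ∫ x : ℂ, ‖x‖ ^ (2 * k) * Real.exp (-‖x‖ ^ 2) =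
      Real.pi * k.factorial := by
    intro k
    have := Complex.integral_rpow_mul_exp_neg_rpow (p := 2) (q := (2 * k : ℕ)) (by norm_num)
      (by have : (0 : ℝ) ≤ (2 * k : ℕ) := Nat.cast_nonneg _
          linarith)
    simp only [Real.rpow_natCast, Real.rpow_two] at this
    rw [this, show (((2 * k : ℕ) : ℝ) + 2) / 2 = k + 1 by push_cast; ring,
      Real.Gamma_nat_eq_factorial]
    ring
  change ∫ x : Fin d → ℂ, ‖(e x) i₀‖ ^ (2 * k) * Real.exp (-‖e x‖ ^ 2) = _
  simp_rw [h1]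
  rw [integral_fintype_prod_volume_eq_prod
    (fun i x => ‖x‖ ^ (2 * (if i = i₀ then k else 0)) * Real.exp (-‖x‖ ^ 2))]
  simp_rw [h2]
  rw [prod_mul_distrib, prod_const, card_univ, Fintype.card_fin, prod_eq_single i₀]
  · simp
  · intro i _ hi; simp [hi]
  · simp

/-- Coordinates in an orthonormal basis having ζ as its `i₀`-th vector. The isometry is taken over ℝ
because that is what preserves Lebesgue measure. -/
lemma exists_isometry_coord {d : ℕ} (i₀ : Fin d) {ζ : Cd d} (hζ : ‖ζ‖ = 1) :
    ∃ U : Cd d ≃ₗᵢ[ℝ] Cd d, ∀ w, (U w) i₀ = inner ℂ ζ w := by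
  obtain ⟨b, hb⟩ := Orthonormal.exists_orthonormalBasis_extension_of_card_eq (𝕜 := ℂ)
    (E := Cd d) (ι := Fin d) (by simp) (v := fun _ => ζ) (s := {i₀}) (by
      refine ⟨fun i => hζ, fun i j hij => (hij (Subsingleton.elim _ _)).elim⟩)
  refine ⟨⟨b.repr.toLinearEquiv.restrictScalars ℝ, fun x => b.repr.norm_map x⟩, fun w => ?_⟩
  have := b.repr_apply_apply w i₀
  rw [hb i₀ rfl] at this
  exact this

lemma integral_gaussian_inner {d : ℕ} (hd : 1 ≤ d) : ∃ c : ℝ, 0 < c ∧ ∀ ζ : Cd d, ‖ζ‖ = 1 →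
    ∀ k : ℕ, ∫ w : Cd d, ‖inner ℂ w ζ‖ ^ (2 * k) * Real.exp (-‖w‖ ^ 2) = c * k.factorial := by
  obtain ⟨c, hc, h⟩ := integral_gaussian_basis (⟨0, hd⟩ : Fin d)
  refine ⟨c, hc, fun ζ hζ k => ?_⟩
  obtain ⟨U, hU⟩ := exists_isometry_coord ⟨0, hd⟩ hζ
  rw [← h, ← U.measurePreserving.integral_comp U.toHomeomorph.measurableEmbedding
    (fun w => ‖w (⟨0, hd⟩ : Fin d)‖ ^ (2 * k) * Real.exp (-‖w‖ ^ 2))]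
  refine integral_congr_ae (.of_forall fun w => ?_)
  simp only [U.norm_map, hU, norm_inner_symm w ζ]

/-- The moments of `|⟨ζ, w⟩|²` with respect to `(1 - |w|²)^σ dw` on the ball. -/
lemma setIntegral_ball_inner_pow {d : ℕ} (hd : 1 ≤ d) {σ : ℝ} (hσ : -1 < σ) :
    ∃ M : ℝ, 0 < M ∧ ∀ ζ : Cd d, ‖ζ‖ = 1 → ∀ k : ℕ,
      ∫ w in unitBall d, ‖inner ℂ w ζ‖ ^ (2 * k) * (1 - ‖w‖ ^ 2) ^ σ =
        M * (k.factorial / rising (d + 1 + σ) k) := by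
  obtain ⟨c, hc, h⟩ := integral_gaussian_inner hd
  have hl : 0 < (d : ℝ) + 1 + σ := by
    have : (0 : ℝ) ≤ d := d.cast_nonneg
    linarith
  have hG := Real.Gamma_pos_of_pos hl
  have hG' := Real.Gamma_pos_of_pos (show 0 < σ + 1 by linarith)
  refine ⟨c * Real.Gamma (σ + 1) / Real.Gamma (d + 1 + σ), by positivity, fun ζ hζ k => ?_⟩
  obtain ⟨A, hA⟩ := integral_inner_pow_mul_radial hd k ζ
  -- The angular constant `A` is the same for every radial weight: the Gaussian, where the moment is
  -- known, determines it, and the weight (1 - t)^σ cut off at t = 1 then yields the moment on the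
  -- ball.
  have h1 := hA fun t => Real.exp (-t)
  have h2 := hA fun t => if t < 1 then (1 - t) ^ σ else 0
  rw [h ζ hζ, integral_Ioi_exp] at h1
  rw [integral_Ioi_beta _ hσ, show (((k + d - 1 : ℕ) : ℝ) + 1 + (σ + 1)) = d + 1 + σ + k by
    rw [Nat.cast_sub (by omega)]; push_cast; ring, Gamma_add_nat hl] at h2
  have hr := rising_pos hl k
  have h3 : ∫ w in unitBall d, ‖inner ℂ w ζ‖ ^ (2 * k) * (1 - ‖w‖ ^ 2) ^ σ =
      ∫ w : Cd d, ‖inner ℂ w ζ‖ ^ (2 * k) * (if ‖w‖ ^ 2 < 1 then (1 - ‖w‖ ^ 2) ^ σ else 0) := by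
    rw [← integral_indicator measurableSet_ball]
    refine integral_congr_ae (.of_forall fun w => ?_)
    have : ‖w‖ ^ 2 < 1 ↔ ‖w‖ < 1 := by
      rw [sq_lt_one_iff₀ (norm_nonneg _)]
    by_cases hw : ‖w‖ < 1 <;> simp [Set.indicator, this, hw]
  rw [h3, h2]
  have h4 : A * ((k + d - 1).factorial * Real.Gamma (σ + 1)) =
      c * k.factorial * Real.Gamma (σ + 1) := by rw [h1]; ring
  rw [← mul_div_assoc, h4]
  field_simp

end BergmanBloch

/-! ### The weighted probability measure and orthogonality of the powers of ⟨z, w⟩ -/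

namespace BergmanBloch

open Filter Topology Finset

/-- The probability measure `c_σ (1 - |w|²)^σ dv(w)` on the ball. -/
noncomputable def weightedMeasure (d : ℕ) (σ : ℝ) : Measure (Cd d) :=
  (ballMeasure d).withDensity
    fun w => ((normConst d σ * (1 - ‖w‖ ^ 2) ^ σ).toNNReal : ℝ≥0∞)

variable {d : ℕ} {σ : ℝ}

lemma ae_ballMeasure : ∀ᵐ w ∂ballMeasure d, w ∈ unitBall d :=
  Measure.ae_smul_measure (ae_restrict_mem measurableSet_ball) _

lemma weightedMeasure_absolutelyContinuous : weightedMeasure d σ ≪ ballMeasure d :=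
  withDensity_absolutelyContinuous _ _

lemma ae_weightedMeasure : ∀ᵐ w ∂weightedMeasure d σ, w ∈ unitBall d :=
  weightedMeasure_absolutelyContinuous.ae_le ae_ballMeasure

lemma ballMeasure_ne_top : (volume (unitBall d))⁻¹ ≠ ∞ :=
  ENNReal.inv_ne_top.2 (Metric.measure_ball_pos _ _ one_pos).ne'

lemma integral_ballMeasure (h : Cd d → ℝ) :
    ∫ w, h w ∂ballMeasure d =
      (volume (unitBall d))⁻¹.toReal * ∫ w in unitBall d, h w := by
  rw [ballMeasure, integral_smul_measure, smul_eq_mul]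

lemma volume_inv_pos : 0 < (volume (unitBall d))⁻¹.toReal :=
  ENNReal.toReal_pos (ENNReal.inv_ne_zero.2 measure_ball_lt_top.ne) ballMeasure_ne_top

lemma exists_norm_eq_one (hd : 1 ≤ d) : ∃ ζ : Cd d, ‖ζ‖ = 1 :=
  ⟨EuclideanSpace.single ⟨0, hd⟩ 1, by simp⟩

lemma exists_eq_norm_smul (hd : 1 ≤ d) (z : Cd d) :
    ∃ ζ : Cd d, ‖ζ‖ = 1 ∧ z = (‖z‖ : ℂ) • ζ := by
  obtain ⟨ζ, hζ⟩ := exists_norm_eq_one hd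
  by_cases hz : z = 0
  · exact ⟨ζ, hζ, by simp [hz]⟩
  · have : (‖z‖ : ℂ) ≠ 0 := by simpa using hz
    refine ⟨(‖z‖ : ℂ)⁻¹ • z, ?_, ?_⟩
    · rw [norm_smul]; simp [hz]
    · rw [smul_smul, mul_inv_cancel₀ this, one_smul]

lemma integral_weight_pos (hd : 1 ≤ d) (hσ : -1 < σ) :
    0 < ∫ w, (1 - ‖w‖ ^ 2) ^ σ ∂(ballMeasure d) := by
  obtain ⟨M, hM, h⟩ := setIntegral_ball_inner_pow hd hσ
  obtain ⟨ζ, hζ⟩ := exists_norm_eq_one hd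
  have h0 := h ζ hζ 0
  simp only [mul_zero, pow_zero, one_mul, rising_zero, Nat.factorial_zero, Nat.cast_one, div_one,
    mul_one] at h0
  rw [integral_ballMeasure, h0]
  exact mul_pos volume_inv_pos hM

lemma normConst_pos (hd : 1 ≤ d) (hσ : -1 < σ) : 0 < normConst d σ :=
  inv_pos.2 (integral_weight_pos hd hσ)

lemma measurable_weight :
    Measurable fun w : Cd d => (normConst d σ * (1 - ‖w‖ ^ 2) ^ σ).toNNReal := by
  fun_prop

lemma weight_nonneg {w : Cd d} (hw : w ∈ unitBall d) : 0 ≤ (1 - ‖w‖ ^ 2) ^ σ := by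
  have : ‖w‖ < 1 := by simpa using hw
  exact Real.rpow_nonneg (by nlinarith [norm_nonneg w]) _

lemma integral_weightedMeasure (hd : 1 ≤ d) (hσ : -1 < σ) {E : Type*} [NormedAddCommGroup E]
    [NormedSpace ℝ E] (h : Cd d → E) :
    ∫ w, h w ∂weightedMeasure d σ =
      normConst d σ • ∫ w, ((1 - ‖w‖ ^ 2) ^ σ) • h w ∂ballMeasure d := by
  rw [weightedMeasure, integral_withDensity_eq_integral_smul measurable_weight,
    ← integral_smul]
  refine integral_congr_ae ?_
  filter_upwards [ae_ballMeasure] with w hw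
  rw [NNReal.smul_def, Real.coe_toNNReal _ (mul_nonneg (normConst_pos hd hσ).le (weight_nonneg hw)),
    mul_smul]

lemma integrable_weightedMeasure_iff (hd : 1 ≤ d) (hσ : -1 < σ) {E : Type*} [NormedAddCommGroup E]
    [NormedSpace ℝ E] (h : Cd d → E) :
    Integrable h (weightedMeasure d σ) ↔
      Integrable (fun w => ((1 - ‖w‖ ^ 2) ^ σ) • h w) (ballMeasure d) := by
  rw [weightedMeasure, integrable_withDensity_iff_integrable_smul measurable_weight]
  refine Iff.trans (integrable_congr ?_) (integrable_fun_smul_iff (normConst_pos hd hσ).ne' _)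
  filter_upwards [ae_ballMeasure] with w hw
  rw [NNReal.smul_def, Real.coe_toNNReal _ (mul_nonneg (normConst_pos hd hσ).le (weight_nonneg hw)),
    mul_smul]

lemma integral_weightedMeasure_one (hd : 1 ≤ d) (hσ : -1 < σ) :
    ∫ _, (1 : ℝ) ∂weightedMeasure d σ = 1 := by
  rw [integral_weightedMeasure hd hσ]
  simp only [smul_eq_mul, mul_one]
  exact inv_mul_cancel₀ (integral_weight_pos hd hσ).ne'

lemma isProbabilityMeasure_weightedMeasure (hd : 1 ≤ d) (hσ : -1 < σ) :
    IsProbabilityMeasure (weightedMeasure d σ) := by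
  have h := integral_weightedMeasure_one hd hσ
  -- A Bochner integral of a non-integrable function is 0, so the value 1 already forces finiteness
  -- of the measure.
  have hi : Integrable (fun _ => (1 : ℝ)) (weightedMeasure d σ) :=
    .of_integral_ne_zero (by rw [h]; exact one_ne_zero)
  have : IsFiniteMeasure (weightedMeasure d σ) := by
    simpa [integrable_const_iff] using hi
  rw [isProbabilityMeasure_iff_real]
  simpa using h

lemma integral_inner_pow_of_norm_eq_one (hd : 1 ≤ d) (hσ : -1 < σ) {ζ : Cd d} (hζ : ‖ζ‖ = 1)
    (k : ℕ) :
    ∫ w, ‖inner ℂ w ζ‖ ^ (2 * k) ∂weightedMeasure d σ =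
      k.factorial / rising (d + 1 + σ) k := by
  obtain ⟨M, hM, h⟩ := setIntegral_ball_inner_pow hd hσ
  have h0 := h ζ hζ 0
  simp only [mul_zero, pow_zero, one_mul, rising_zero, Nat.factorial_zero, Nat.cast_one, div_one,
    mul_one] at h0
  rw [integral_weightedMeasure hd hσ, normConst, integral_ballMeasure, integral_ballMeasure, h0]
  simp only [smul_eq_mul, mul_comm ((1 - ‖_‖ ^ 2) ^ σ)]
  rw [h ζ hζ]
  have := (volume_inv_pos (d := d)).ne'
  field_simp

/-- The even moments of `|⟨z, w⟩|`. -/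
lemma integral_inner_pow (hd : 1 ≤ d) (hσ : -1 < σ) (z : Cd d) (k : ℕ) :
    ∫ w, ‖inner ℂ w z‖ ^ (2 * k) ∂weightedMeasure d σ =
      k.factorial / rising (d + 1 + σ) k * (‖z‖ ^ 2) ^ k := by
  obtain ⟨ζ, hζ, hz⟩ := exists_eq_norm_smul hd z
  have h1 : ∀ w : Cd d, ‖inner ℂ w z‖ ^ (2 * k) = (‖z‖ ^ 2) ^ k * ‖inner ℂ w ζ‖ ^ (2 * k) := by
    intro w
    conv_lhs => rw [hz]
    rw [inner_smul_right, norm_mul, mul_pow, pow_mul ‖(‖z‖ : ℂ)‖]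
    simp
  simp_rw [h1]
  rw [integral_const_mul, integral_inner_pow_of_norm_eq_one hd hσ hζ, mul_comm]

/-- Invariance of the weighted measure under `w ↦ c w`, `|c| = 1`. -/
lemma integral_rotate (hd : 1 ≤ d) (hσ : -1 < σ) {c : ℂ} (hc : ‖c‖ = 1) (h : Cd d → ℂ) :
    ∫ w, h (c • w) ∂weightedMeasure d σ = ∫ w, h w ∂weightedMeasure d σ := by
  have hc0 : c ≠ 0 := by rintro rfl; simp at hc
  let U : Cd d ≃ₗᵢ[ℝ] Cd d :=
    ⟨(LinearEquiv.smulOfNeZero ℂ (Cd d) c hc0).restrictScalars ℝ, fun x => by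
      change ‖c • x‖ = ‖x‖
      rw [norm_smul, hc, one_mul]⟩
  rw [integral_weightedMeasure hd hσ, integral_weightedMeasure hd hσ, ballMeasure,
    integral_smul_measure, integral_smul_measure, ← integral_indicator measurableSet_ball,
    ← integral_indicator measurableSet_ball,
    ← U.measurePreserving.integral_comp U.toHomeomorph.measurableEmbedding
      (Set.indicator (unitBall d) fun w => (1 - ‖w‖ ^ 2) ^ σ • h w)]
  congr 3
  ext w
  have : c • w ∈ unitBall d ↔ w ∈ unitBall d := by simp [norm_smul, hc]
  change _ = Set.indicator (unitBall d) (fun w => (1 - ‖w‖ ^ 2) ^ σ • h w) (c • w)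
  by_cases hw : w ∈ unitBall d
  · rw [Set.indicator_of_mem hw, Set.indicator_of_mem (this.2 hw), norm_smul, hc, one_mul]
  · rw [Set.indicator_of_notMem hw, Set.indicator_of_notMem (mt this.1 hw)]

/-- The rotation by the angle π/(k - j) preserves the measure and multiplies the integrand by -1. -/
lemma integral_inner_pow_mul_conj_of_ne (hd : 1 ≤ d) (hσ : -1 < σ) (z : Cd d) {j k : ℕ}
    (hjk : j ≠ k) :
    ∫ w, inner ℂ w z ^ j * starRingEnd ℂ (inner ℂ w z) ^ k ∂weightedMeasure d σ = 0 := by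
  set θ : ℝ := Real.pi / ((k : ℝ) - j)
  have hne : (k : ℝ) - j ≠ 0 := by
    rw [sub_ne_zero]; exact_mod_cast hjk.symm
  set c : ℂ := Complex.exp (θ * Complex.I)
  have hc : ‖c‖ = 1 := Complex.norm_exp_ofReal_mul_I θ
  have h := integral_rotate hd hσ hc
    (fun w => inner ℂ w z ^ j * starRingEnd ℂ (inner ℂ w z) ^ k)
  have h1 : starRingEnd ℂ c ^ j * c ^ k = -1 := by
    have : starRingEnd ℂ c = Complex.exp (-(θ * Complex.I)) := by
      rw [← Complex.exp_conj]; simp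
    rw [this, ← Complex.exp_nat_mul, ← Complex.exp_nat_mul, ← Complex.exp_add,
      ← Complex.exp_pi_mul_I]
    congr 1
    have : (Real.pi : ℂ) = θ * ((k : ℂ) - j) := by
      rw [← Complex.ofReal_natCast, ← Complex.ofReal_natCast, ← Complex.ofReal_sub,
        ← Complex.ofReal_mul]
      congr 1
      exact (div_mul_cancel₀ _ hne).symm
    rw [this]; ring
  have h2 : ∀ w : Cd d, inner ℂ (c • w) z ^ j * starRingEnd ℂ (inner ℂ (c • w) z) ^ k =
      -1 * (inner ℂ w z ^ j * starRingEnd ℂ (inner ℂ w z) ^ k) := by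
    intro w
    rw [inner_smul_left, map_mul, Complex.conj_conj, mul_pow, mul_pow, ← h1]
    ring
  simp_rw [h2] at h
  rw [integral_const_mul] at h
  linear_combination (-1 / 2 : ℂ) * h

end BergmanBloch

/-! ### The integral of a power of |1 - ⟨z, w⟩| as a hypergeometric series -/

namespace BergmanBloch

open Filter Topology Finset

variable {d : ℕ} {σ : ℝ}

lemma norm_inner_le_of_mem {w : Cd d} (hw : w ∈ unitBall d) (z : Cd d) : ‖inner ℂ w z‖ ≤ ‖z‖ := by
  have hw' : ‖w‖ ≤ 1 := by simpa using (mem_ball_zero_iff.1 hw).le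
  exact (norm_inner_le_norm w z).trans (mul_le_of_le_one_left (norm_nonneg _) hw')

lemma one_sub_norm_le {w z : Cd d} (hw : w ∈ unitBall d) : 1 - ‖z‖ ≤ ‖1 - inner ℂ w z‖ := by
  have h1 := norm_sub_norm_le (1 : ℂ) (inner ℂ w z)
  have h2 := norm_inner_le_of_mem hw z
  simp only [norm_one] at h1
  linarith

lemma one_sub_inner_mem_slitPlane {w z : Cd d} (hw : w ∈ unitBall d) (hz : z ∈ unitBall d) :
    1 - inner ℂ w z ∈ Complex.slitPlane := by
  left
  have h1 : ‖z‖ < 1 := mem_ball_zero_iff.1 hz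
  have h2 := (Complex.re_le_norm _).trans (norm_inner_le_of_mem hw z)
  simp only [Complex.sub_re, Complex.one_re]
  linarith

lemma measurable_cpow_kernel (z : Cd d) (a : ℂ) :
    Measurable fun w : Cd d => (1 - inner ℂ w z) ^ a := by
  have : Measurable fun w : Cd d => inner ℂ w z := (by fun_prop : Continuous _).measurable
  fun_prop

lemma integrable_inner_pow (hd : 1 ≤ d) (hσ : -1 < σ) (z : Cd d) (j k : ℕ) :
    Integrable (fun w => inner ℂ w z ^ j * starRingEnd ℂ (inner ℂ w z) ^ k)
      (weightedMeasure d σ) := by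
  have := isProbabilityMeasure_weightedMeasure hd hσ
  refine Integrable.of_bound (C := ‖z‖ ^ j * ‖z‖ ^ k) ?_ ?_
  · exact (by fun_prop : Continuous fun w : Cd d =>
      inner ℂ w z ^ j * starRingEnd ℂ (inner ℂ w z) ^ k).aestronglyMeasurable
  · filter_upwards [ae_weightedMeasure] with w hw
    rw [norm_mul, norm_pow, norm_pow, RCLike.norm_conj]
    have := norm_inner_le_of_mem hw z
    gcongr

/-- Parseval: after expanding the square, orthogonality leaves only the diagonal terms. -/
lemma integral_norm_sq_sum (hd : 1 ≤ d) (hσ : -1 < σ) (z : Cd d) (c : ℕ → ℝ) (K : ℕ) :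
    ∫ w, ‖∑ k ∈ range K, (c k : ℂ) * inner ℂ w z ^ k‖ ^ 2 ∂weightedMeasure d σ =
      ∑ k ∈ range K, c k ^ 2 * (k.factorial / rising (d + 1 + σ) k * (‖z‖ ^ 2) ^ k) := by
  rw [← Complex.ofReal_inj, ← integral_complex_ofReal]
  have h1 : ∀ w : Cd d, ((‖∑ k ∈ range K, (c k : ℂ) * inner ℂ w z ^ k‖ ^ 2 : ℝ) : ℂ) =
      ∑ j ∈ range K, ∑ k ∈ range K, ((c j : ℂ) * c k) *
        (inner ℂ w z ^ j * starRingEnd ℂ (inner ℂ w z) ^ k) := by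
    intro w
    rw [Complex.ofReal_pow, ← Complex.mul_conj', map_sum, sum_mul_sum]
    refine sum_congr rfl fun j _ => sum_congr rfl fun k _ => ?_
    simp only [map_mul, map_pow, Complex.conj_ofReal]
    ring
  simp_rw [h1]
  have hint : ∀ j k, Integrable (fun w => ((c j : ℂ) * c k) *
      (inner ℂ w z ^ j * starRingEnd ℂ (inner ℂ w z) ^ k)) (weightedMeasure d σ) :=
    fun j k => (integrable_inner_pow hd hσ z j k).const_mul _
  rw [integral_finsetSum _ fun j _ => integrable_finsetSum _ fun k _ => hint j k,
    Complex.ofReal_sum]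
  refine sum_congr rfl fun j hj => ?_
  rw [integral_finsetSum _ fun k _ => hint j k, sum_eq_single j]
  · rw [integral_const_mul, ← integral_inner_pow hd hσ z j, Complex.ofReal_mul,
      ← integral_complex_ofReal]
    congr 1
    · push_cast; ring
    · refine integral_congr_ae (.of_forall fun w => ?_)
      simp only
      rw [← mul_pow, Complex.mul_conj', ← pow_mul]
      push_cast; rfl
  · intro k _ hk
    rw [integral_const_mul, integral_inner_pow_mul_conj_of_ne hd hσ z hk.symm, mul_zero]
  · intro h; exact absurd hj h

/-- The expansion of `∫ |1 - ⟨z, w⟩|^{-2a} dv_σ(w)` in powers of `|z|²`. -/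
lemma hasSum_integral_kernel (hd : 1 ≤ d) (hσ : -1 < σ) {z : Cd d} (hz : z ∈ unitBall d)
    {s : ℝ} (hs : 0 < s) :
    HasSum (fun k => hypCoeff (d + 1 + σ) s k * (‖z‖ ^ 2) ^ k)
      (∫ w, ‖1 - inner ℂ w z‖ ^ (-(d + 1 + σ + s)) ∂weightedMeasure d σ) := by
  have hl : 0 < (d : ℝ) + 1 + σ := by
    have : (0 : ℝ) ≤ d := d.cast_nonneg
    linarith
  have := isProbabilityMeasure_weightedMeasure hd hσ
  have hz1 : ‖z‖ < 1 := mem_ball_zero_iff.1 hz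
  -- Half of the exponent, so that the integrand is the squared modulus of the holomorphic function
  -- (1 - u)^(-a).
  set a := ((d : ℝ) + 1 + σ + s) / 2
  have ha : 0 < a := by positivity
  set c : ℕ → ℝ := fun k => rising a k / k.factorial
  have hc : ∀ k, 0 ≤ c k := fun k => by have := rising_pos ha k; positivity
  have hcoef : ∀ k, hypCoeff (d + 1 + σ) s k * (‖z‖ ^ 2) ^ k =
      c k ^ 2 * (k.factorial / rising (d + 1 + σ) k * (‖z‖ ^ 2) ^ k) := by
    intro k
    have h1 := (rising_pos hl k).ne'
    have h9 : ((k.factorial : ℕ) : ℝ) ≠ 0 := by positivity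
    simp only [hypCoeff, c, a]
    field_simp
  rw [hasSum_iff_tendsto_nat_of_nonneg]
  swap
  · intro k
    have := rising_pos hl k
    rw [hcoef]; positivity
  simp_rw [hcoef, ← integral_norm_sq_sum hd hσ z c]
  have hb := hasSum_one_sub_rpow a (norm_nonneg z) hz1
  -- The coefficients are nonnegative and |⟨z, w⟩| ≤ |z|, so every partial sum is bounded by the
  -- full series at |z|, which is (1 - |z|)^(-a).
  refine tendsto_integral_of_dominated_convergence (fun _ => ((1 - ‖z‖) ^ (-a)) ^ 2) ?_ ?_ ?_ ?_
  · intro K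
    exact (by fun_prop : Continuous fun w : Cd d =>
      ‖∑ k ∈ range K, (c k : ℂ) * inner ℂ w z ^ k‖ ^ 2).aestronglyMeasurable
  · exact integrable_const _
  · intro K
    filter_upwards [ae_weightedMeasure] with w hw
    rw [norm_pow, norm_norm]
    gcongr
    refine (norm_sum_le _ _).trans (le_trans (sum_le_sum fun k _ => ?_)
      (sum_le_hasSum (range K) (fun k _ => mul_nonneg (hc k) (by positivity)) hb))
    rw [norm_mul, norm_pow, Complex.norm_real, Real.norm_of_nonneg (hc k)]
    have := norm_inner_le_of_mem hw z
    have := hc k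
    gcongr
  · filter_upwards [ae_weightedMeasure] with w hw
    have h1 := (hasSum_one_sub_cpow a
      ((norm_inner_le_of_mem hw z).trans_lt hz1)).tendsto_sum_nat.norm.pow 2
    have h2 : ‖(1 - inner ℂ w z) ^ (-(a : ℂ))‖ ^ 2 = ‖1 - inner ℂ w z‖ ^ (-(d + 1 + σ + s)) := by
      rw [← Complex.ofReal_neg, Complex.norm_cpow_real, ← Real.rpow_mul_natCast (norm_nonneg _)]
      congr 1
      simp only [a]; push_cast; ring
    rw [h2] at h1
    exact h1

lemma integral_kernel_le (hd : 1 ≤ d) (hσ : -1 < σ) {z : Cd d} (hz : z ∈ unitBall d)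
    {s : ℝ} (hs : 0 < s) :
    ∫ w, ‖1 - inner ℂ w z‖ ^ (-(d + 1 + σ + s)) ∂weightedMeasure d σ ≤
      gammaRatio (d + 1 + σ) s * (1 - ‖z‖ ^ 2) ^ (-s) := by
  have hl : 0 < (d : ℝ) + 1 + σ := by
    have : (0 : ℝ) ≤ d := d.cast_nonneg
    linarith
  have hz1 : ‖z‖ < 1 := mem_ball_zero_iff.1 hz
  exact hasSum_hypCoeff_le hl hs (by positivity) (by nlinarith [norm_nonneg z])
    (hasSum_integral_kernel hd hσ hz hs)

lemma tendsto_integral_kernel (hd : 1 ≤ d) (hσ : -1 < σ) {ζ : Cd d} (hζ : ‖ζ‖ = 1)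
    {s : ℝ} (hs : 0 < s) :
    Tendsto (fun r : ℝ => (1 - r ^ 2) ^ s *
      ∫ w, ‖1 - inner ℂ w ((r : ℂ) • ζ)‖ ^ (-(d + 1 + σ + s)) ∂weightedMeasure d σ)
      (𝓝[<] 1) (𝓝 (gammaRatio (d + 1 + σ) s)) := by
  have hl : 0 < (d : ℝ) + 1 + σ := by
    have : (0 : ℝ) ≤ d := d.cast_nonneg
    linarith
  have h := tendsto_hypergeometric hl hs (F := fun x =>
    ∫ w, ‖1 - inner ℂ w ((√x : ℂ) • ζ)‖ ^ (-(d + 1 + σ + s)) ∂weightedMeasure d σ) (by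
      intro x hx0 hx
      have hn : ‖(√x : ℂ) • ζ‖ = √x := by
        rw [norm_smul, hζ, mul_one, Complex.norm_real, Real.norm_of_nonneg (Real.sqrt_nonneg _)]
      have := hasSum_integral_kernel hd hσ (z := (√x : ℂ) • ζ) (by
        rw [mem_ball_zero_iff, hn, Real.sqrt_lt' one_pos]; simpa using hx) hs
      rwa [hn, Real.sq_sqrt hx0] at this)
  have hsq : Tendsto (fun r : ℝ => r ^ 2) (𝓝[<] 1) (𝓝[<] 1) := by
    refine tendsto_nhdsWithin_of_tendsto_nhds_of_eventually_within _ ?_ ?_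
    · have : ContinuousAt (fun r : ℝ => r ^ 2) 1 := by fun_prop
      have h := this.tendsto
      simp only [one_pow] at h
      exact h.mono_left nhdsWithin_le_nhds
    · filter_upwards [Ico_mem_nhdsLT (show (0 : ℝ) < 1 by norm_num)] with r hr
      have := hr.1; have := hr.2
      rw [Set.mem_Iio]; nlinarith
  refine (h.comp hsq).congr' ?_
  filter_upwards [Ico_mem_nhdsLT (show (0 : ℝ) < 1 by norm_num)] with r hr
  simp only [Function.comp, Real.sqrt_sq hr.1]

end BergmanBloch

/-! ### Kernel integrals and their derivatives -/

namespace BergmanBloch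

open Filter Topology Finset

variable {d : ℕ} {σ : ℝ}

/-- The integral operator with kernel `(1 - ⟨z, w⟩)^(-s)` with respect to `dv_σ`. -/
noncomputable def kernelIntegral (σ s : ℝ) (g : Cd d → ℂ) (z : Cd d) : ℂ :=
  ∫ w, (1 - inner ℂ w z) ^ (-(s : ℂ)) * g w ∂weightedMeasure d σ

lemma norm_kernel (s : ℝ) (w z : Cd d) :
    ‖(1 - inner ℂ w z) ^ (-(s : ℂ))‖ = ‖1 - inner ℂ w z‖ ^ (-s) := by
  rw [← Complex.ofReal_neg, Complex.norm_cpow_real]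

lemma norm_kernel_le {s : ℝ} (hs : 0 ≤ s) {w z : Cd d} {R : ℝ} (hw : w ∈ unitBall d)
    (hz : ‖z‖ ≤ R) (hR : R < 1) : ‖(1 - inner ℂ w z) ^ (-(s : ℂ))‖ ≤ (1 - R) ^ (-s) := by
  rw [norm_kernel]
  exact Real.rpow_le_rpow_of_nonpos (by linarith)
    ((by linarith : 1 - R ≤ 1 - ‖z‖).trans (one_sub_norm_le hw)) (by linarith)

lemma aestronglyMeasurable_kernel_mul (s : ℂ) {g : Cd d → ℂ}
    (hg : AEStronglyMeasurable g (weightedMeasure d σ)) (z : Cd d) :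
    AEStronglyMeasurable (fun w => (1 - inner ℂ w z) ^ s * g w) (weightedMeasure d σ) :=
  (measurable_cpow_kernel z s).aestronglyMeasurable.mul hg

lemma integrable_kernel_mul (hd : 1 ≤ d) (hσ : -1 < σ) {s : ℝ} (hs : 0 ≤ s) {g : Cd d → ℂ} {M : ℝ}
    (hg : AEStronglyMeasurable g (weightedMeasure d σ))
    (hM : ∀ᵐ w ∂weightedMeasure d σ, ‖g w‖ ≤ M) {z : Cd d} (hz : z ∈ unitBall d) :
    Integrable (fun w => (1 - inner ℂ w z) ^ (-(s : ℂ)) * g w) (weightedMeasure d σ) := by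
  have := isProbabilityMeasure_weightedMeasure hd hσ
  have hz1 : ‖z‖ < 1 := mem_ball_zero_iff.1 hz
  refine Integrable.of_bound (C := (1 - ‖z‖) ^ (-s) * M)
    (aestronglyMeasurable_kernel_mul _ hg z) ?_
  filter_upwards [ae_weightedMeasure, hM] with w hw hgw
  rw [norm_mul]
  exact mul_le_mul (norm_kernel_le hs hw le_rfl hz1) hgw (norm_nonneg _)
    (Real.rpow_nonneg (by linarith) _)

lemma partialDeriv_kernelIntegral (hd : 1 ≤ d) (hσ : -1 < σ) {s : ℝ} (hs : 0 ≤ s) {g : Cd d → ℂ}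
    {M : ℝ} (hg : AEStronglyMeasurable g (weightedMeasure d σ))
    (hM : ∀ᵐ w ∂weightedMeasure d σ, ‖g w‖ ≤ M) {z : Cd d} (hz : z ∈ unitBall d) (j : Fin d) :
    partialDeriv j (kernelIntegral σ s g) z =
      s * kernelIntegral σ (s + 1) (fun w => starRingEnd ℂ (w j) * g w) z := by
  have := isProbabilityMeasure_weightedMeasure hd hσ
  have hz1 : ‖z‖ < 1 := mem_ball_zero_iff.1 hz
  set v : Cd d := EuclideanSpace.single j 1
  have hv : ‖v‖ = 1 := by simp [v]
  -- The midpoint of |z| and 1: the points z + t e_j with |t| < `ε` stay in the ball of radius `R`,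
  -- where the differentiated kernel is bounded uniformly in w.
  set R := (1 + ‖z‖) / 2
  have hR : R < 1 := by simp only [R]; linarith
  set ε := (1 - ‖z‖) / 2
  have hε : 0 < ε := by simp only [ε]; linarith
  have hball : ∀ t ∈ Metric.ball (0 : ℂ) ε, ‖z + t • v‖ ≤ R := by
    intro t ht
    have ht' : ‖t‖ < ε := mem_ball_zero_iff.1 ht
    have := norm_add_le z (t • v)
    rw [norm_smul, hv, mul_one] at this
    simp only [R, ε] at *
    linarith
  have hmem : ∀ t ∈ Metric.ball (0 : ℂ) ε, z + t • v ∈ unitBall d := fun t ht =>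
    mem_ball_zero_iff.2 ((hball t ht).trans_lt hR)
  have key := hasDerivAt_integral_of_dominated_loc_of_deriv_le (μ := weightedMeasure d σ) (𝕜 := ℂ)
    (F := fun t w => (1 - inner ℂ w (z + t • v)) ^ (-(s : ℂ)) * g w)
    (F' := fun t w => s * ((1 - inner ℂ w (z + t • v)) ^ (-((s + 1 : ℝ) : ℂ)) *
      (starRingEnd ℂ (w j) * g w)))
    (x₀ := 0) (s := Metric.ball (0 : ℂ) ε) (bound := fun _ => s * ((1 - R) ^ (-(s + 1)) * (1 * M)))
    (Metric.ball_mem_nhds 0 hε)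
    (.of_forall fun t => aestronglyMeasurable_kernel_mul _ hg _)
    (by simpa using integrable_kernel_mul hd hσ hs hg hM hz)
    ((aestronglyMeasurable_kernel_mul _ ((by fun_prop :
      Continuous fun w : Cd d => starRingEnd ℂ (w j)).aestronglyMeasurable.mul hg) _).const_mul _)
    (by
      filter_upwards [ae_weightedMeasure, hM] with w hw hgw t ht
      rw [norm_mul, norm_mul, norm_mul, Complex.norm_real, Real.norm_of_nonneg hs, RCLike.norm_conj]
      have h1 := norm_kernel_le (s := s + 1) (by linarith) hw (hball t ht) hR
      have h2 : ‖w j‖ ≤ 1 :=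
        (PiLp.norm_apply_le w j).trans (mem_ball_zero_iff.1 hw).le
      have h3 : 0 ≤ (1 - R) ^ (-(s + 1)) := Real.rpow_nonneg (by linarith) _
      gcongr)
    (integrable_const _)
    (by
      filter_upwards [ae_weightedMeasure] with w hw t ht
      have hd1 : HasDerivAt (fun t : ℂ => 1 - inner ℂ w (z + t • v)) (-(inner ℂ w v)) t := by
        have : (fun t : ℂ => 1 - inner ℂ w (z + t • v)) =
            fun t => (1 - inner ℂ w z) - t * inner ℂ w v := by
          ext t; rw [inner_add_right, inner_smul_right]; ring
        rw [this]
        simpa using ((hasDerivAt_id t).mul_const (inner ℂ w v)).const_sub (1 - inner ℂ w z)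
      have hd2 := (hd1.cpow_const (c := -(s : ℂ))
        (one_sub_inner_mem_slitPlane hw (hmem t ht))).mul_const (g w)
      refine hd2.congr_deriv ?_
      have hin : inner ℂ w v = starRingEnd ℂ (w j) := by
        simp [v, EuclideanSpace.inner_single_right]
      rw [hin, show -((s + 1 : ℝ) : ℂ) = -(s : ℂ) - 1 by push_cast; ring]
      ring)
  have h := key.2.deriv
  rw [partialDeriv, lineDeriv]
  refine h.trans ?_
  simp only [zero_smul, add_zero]
  rw [integral_const_mul]
  rfl

lemma partialDeriv_congr {f g : Cd d → ℂ} (h : ∀ z ∈ unitBall d, f z = g z) (j : Fin d) {z : Cd d}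
    (hz : z ∈ unitBall d) : partialDeriv j f z = partialDeriv j g z := by
  have hev : f =ᶠ[𝓝 z] g := by
    filter_upwards [Metric.isOpen_ball.mem_nhds hz] with x hx using h x hx
  exact hev.lineDeriv_eq

/-- `f` is the kernel integral of parameter `s + t` of a function of modulus at most `M`,
multiplied by `(s)_t`. -/
def IsKernelIntegral (σ s M : ℝ) (t : ℕ) (g f : Cd d → ℂ) : Prop :=
  AEStronglyMeasurable g (weightedMeasure d σ) ∧ (∀ᵐ w ∂weightedMeasure d σ, ‖g w‖ ≤ M) ∧
    ∀ z ∈ unitBall d, f z = rising s t * kernelIntegral σ (s + t) g z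

lemma IsKernelIntegral.partialDeriv (hd : 1 ≤ d) (hσ : -1 < σ) {s M : ℝ} (hs : 0 ≤ s) {t : ℕ}
    {g f : Cd d → ℂ} (h : IsKernelIntegral σ s M t g f) (j : Fin d) :
    IsKernelIntegral σ s M (t + 1) (fun w => starRingEnd ℂ (w j) * g w) (partialDeriv j f) := by
  obtain ⟨h1, h2, h3⟩ := h
  refine ⟨(by fun_prop : Continuous fun w : Cd d => starRingEnd ℂ (w j)).aestronglyMeasurable.mul
    h1, ?_, fun z hz => ?_⟩
  · filter_upwards [ae_weightedMeasure, h2] with w hw hgw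
    rw [norm_mul, RCLike.norm_conj]
    have h4 : ‖w j‖ ≤ 1 := (PiLp.norm_apply_le w j).trans (mem_ball_zero_iff.1 hw).le
    exact (mul_le_of_le_one_left (norm_nonneg _) h4).trans hgw
  · rw [partialDeriv_congr h3 j hz]
    have h5 : BergmanBloch.partialDeriv j
        (fun z => (rising s t : ℂ) * kernelIntegral σ (s + t) g z) z =
        rising s t * BergmanBloch.partialDeriv j (kernelIntegral σ (s + t) g) z := by
      unfold BergmanBloch.partialDeriv lineDeriv
      exact deriv_const_mul_field _
    rw [h5, partialDeriv_kernelIntegral hd hσ (by positivity) h1 h2 hz, rising_succ]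
    push_cast
    rw [← add_assoc]
    ring

lemma IsKernelIntegral.iterate (hd : 1 ≤ d) (hσ : -1 < σ) {s M : ℝ} (hs : 0 ≤ s) {t : ℕ}
    {g f : Cd d → ℂ} (h : IsKernelIntegral σ s M t g f) (j : Fin d) (m : ℕ) :
    IsKernelIntegral σ s M (t + m) (fun w => starRingEnd ℂ (w j) ^ m * g w)
      ((BergmanBloch.partialDeriv j)^[m] f) := by
  induction m with
  | zero => simpa using h
  | succ m ih =>
    rw [Function.iterate_succ_apply']
    have := ih.partialDeriv hd hσ hs j
    simp only [← mul_assoc, ← pow_succ'] at this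
    exact this

/-- An arbitrary list of coordinates replaces `List.finRange d` so that the induction can run over
the fold defining `mixedPartial`. -/
lemma IsKernelIntegral.foldr (hd : 1 ≤ d) (hσ : -1 < σ) {s M : ℝ} (hs : 0 ≤ s) {t : ℕ}
    {g f : Cd d → ℂ} (h : IsKernelIntegral σ s M t g f) (α : Fin d → ℕ) (l : List (Fin d)) :
    IsKernelIntegral σ s M (t + (l.map α).sum)
      (fun w => (l.map fun j => starRingEnd ℂ (w j) ^ α j).prod * g w)
      (l.foldr (fun j g => (BergmanBloch.partialDeriv j)^[α j] g) f) := by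
  induction l with
  | nil => simpa using h
  | cons j l ih =>
    have := ih.iterate hd hσ hs j (α j)
    simp only [List.map_cons, List.sum_cons, List.prod_cons, List.foldr_cons]
    rw [add_comm (α j), ← add_assoc]
    simpa only [mul_assoc] using this

/-- The derivatives of a kernel integral. -/
lemma mixedPartial_kernelIntegral (hd : 1 ≤ d) (hσ : -1 < σ) {s : ℝ} (hs : 0 ≤ s) {g : Cd d → ℂ}
    {M : ℝ} (hg : AEStronglyMeasurable g (weightedMeasure d σ))
    (hM : ∀ᵐ w ∂weightedMeasure d σ, ‖g w‖ ≤ M) {z : Cd d} (hz : z ∈ unitBall d)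
    {n : ℕ} (α : MultiIndex d n) :
    mixedPartial α.1 (kernelIntegral σ s g) z = rising s n *
      kernelIntegral σ (s + n) (fun w => starRingEnd ℂ (monomialVector n w α) * g w) z := by
  have h0 : IsKernelIntegral σ s M 0 g (kernelIntegral σ s g) :=
    ⟨hg, hM, fun z _ => by simp [rising_zero]⟩
  have h := (h0.foldr hd hσ hs α.1 (List.finRange d)).2.2 z hz
  have hsum : ((List.finRange d).map α.1).sum = n := by
    rw [← Fin.sum_univ_def, α.2]
  have hprod : ∀ w : Cd d, ((List.finRange d).map fun j => starRingEnd ℂ (w j) ^ α.1 j).prod =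
      starRingEnd ℂ (monomialVector n w α) := by
    intro w
    rw [monomialVector, map_prod, ← Fin.prod_univ_def]
    simp only [map_pow]
  simp only [hsum, hprod, zero_add] at h
  exact h

/-! ### Analyticity of kernel integrals -/

/-- The homogeneous terms of the expansion of a kernel integral at the origin. -/
noncomputable def kernelSeries (σ s : ℝ) (g : Cd d → ℂ) :
    FormalMultilinearSeries ℂ (Cd d) ℂ := fun k =>
  ∫ w, (((rising s k / k.factorial : ℝ) : ℂ) * g w) •
    (ContinuousMultilinearMap.mkPiAlgebraFin ℂ k ℂ).compContinuousLinearMap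
      (fun _ => innerSL ℂ w) ∂weightedMeasure d σ

/-- The binomial series in ⟨z, w⟩ is integrated term by term. The k-th term has norm at most M (s)_k
/ k!, hence the radius is at least 1. This gives joint analyticity in all variables, beyond the
existence of partial derivatives. -/
lemma hasFPowerSeriesOnBall_kernelIntegral (hd : 1 ≤ d) (hσ : -1 < σ) {s : ℝ} (hs : 0 < s)
    {g : Cd d → ℂ} {M : ℝ} (hg : AEStronglyMeasurable g (weightedMeasure d σ))
    (hM : ∀ᵐ w ∂weightedMeasure d σ, ‖g w‖ ≤ M) :
    HasFPowerSeriesOnBall (kernelIntegral σ s g) (kernelSeries σ s g) 0 1 := by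
  have := isProbabilityMeasure_weightedMeasure hd hσ
  set c : ℕ → ℝ := fun k => rising s k / k.factorial
  have hc : ∀ k, 0 ≤ c k := fun k => by have := rising_pos hs k; positivity
  have hM0 : 0 ≤ M := by
    obtain ⟨w, hw⟩ := hM.exists
    exact (norm_nonneg _).trans hw
  set T : ∀ k, Cd d → ContinuousMultilinearMap ℂ (fun _ : Fin k => Cd d) ℂ := fun k w =>
    (ContinuousMultilinearMap.mkPiAlgebraFin ℂ k ℂ).compContinuousLinearMap (fun _ => innerSL ℂ w)
  have hT : ∀ k, Continuous (T k) := by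
    intro k
    exact (ContinuousMultilinearMap.compContinuousLinearMapLRight
      (ContinuousMultilinearMap.mkPiAlgebraFin ℂ k ℂ)).cont.comp
        (continuous_pi fun _ => (innerSL ℂ).continuous)
  have hTn : ∀ k, ∀ w ∈ unitBall d, ‖T k w‖ ≤ 1 := by
    intro k w hw
    refine ContinuousMultilinearMap.opNorm_le_bound zero_le_one fun m => ?_
    simp only [T, ContinuousMultilinearMap.compContinuousLinearMap_apply,
      ContinuousMultilinearMap.mkPiAlgebraFin_apply, innerSL_apply_apply]
    rw [List.prod_ofFn, norm_prod, one_mul]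
    exact prod_le_prod (fun _ _ => norm_nonneg _) fun i _ => norm_inner_le_of_mem hw _
  have hbound : ∀ k, ∀ᵐ w ∂weightedMeasure d σ, ‖((c k : ℂ) * g w) • T k w‖ ≤ c k * M := by
    intro k
    filter_upwards [ae_weightedMeasure, hM] with w hw hgw
    rw [norm_smul, norm_mul, Complex.norm_real, Real.norm_of_nonneg (hc k)]
    have h1 := hTn k w hw
    have h2 := hc k
    calc c k * ‖g w‖ * ‖T k w‖ ≤ c k * M * 1 := by gcongr
      _ = c k * M := mul_one _
  have hint : ∀ k, Integrable (fun w => ((c k : ℂ) * g w) • T k w) (weightedMeasure d σ) :=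
    fun k => Integrable.of_bound ((hg.const_mul _).smul (hT k).aestronglyMeasurable) _ (hbound k)
  refine ⟨?_, one_pos, ?_⟩
  · refine ENNReal.le_of_forall_nnreal_lt fun r hr => ?_
    have hr1 : (r : ℝ) < 1 := by exact_mod_cast hr
    have hsum := hasSum_one_sub_rpow s r.2 hr1
    refine FormalMultilinearSeries.le_radius_of_bound _ ((1 - r) ^ (-s) * M) fun k => ?_
    have h1 : ‖kernelSeries σ s g k‖ ≤ c k * M := by
      exact (norm_integral_le_of_norm_le_const (hbound k)).trans_eq (by simp)
    have h2 : c k * r ^ k ≤ (1 - (r : ℝ)) ^ (-s) :=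
      le_hasSum hsum k fun i _ => mul_nonneg (hc i) (pow_nonneg r.2 i)
    calc ‖kernelSeries σ s g k‖ * r ^ k ≤ c k * M * r ^ k := by gcongr
      _ = c k * r ^ k * M := by ring
      _ ≤ _ := by gcongr
  · intro y hy
    have hy1 : ‖y‖ < 1 := by simpa [← ofReal_norm, enorm_eq_nnnorm] using hy
    rw [zero_add]
    have happ : ∀ k, kernelSeries σ s g k (fun _ => y) =
        ∫ w, ((c k : ℂ) * inner ℂ w y ^ k) * g w ∂weightedMeasure d σ := by
      intro k
      have h := (ContinuousMultilinearMap.apply ℂ (fun _ : Fin k => Cd d) ℂ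
        (fun _ => y)).integral_comp_comm (hint k)
      refine h.symm.trans ?_
      refine integral_congr_ae (.of_forall fun w => ?_)
      simp [T]
      ring
    simp_rw [happ]
    have hb : ∀ k, ∀ᵐ w ∂weightedMeasure d σ,
        ‖((c k : ℂ) * inner ℂ w y ^ k) * g w‖ ≤ c k * ‖y‖ ^ k * M := by
      intro k
      filter_upwards [ae_weightedMeasure, hM] with w hw hgw
      rw [norm_mul, norm_mul, norm_pow, Complex.norm_real, Real.norm_of_nonneg (hc k)]
      have h1 := norm_inner_le_of_mem hw y
      have h2 := hc k
      gcongr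
    have hi : ∀ k, Integrable (fun w => ((c k : ℂ) * inner ℂ w y ^ k) * g w)
        (weightedMeasure d σ) := fun k => Integrable.of_bound
      ((by fun_prop : Continuous fun w : Cd d =>
        (c k : ℂ) * inner ℂ w y ^ k).aestronglyMeasurable.mul hg) _ (hb k)
    have hsum := hasSum_integral_of_summable_integral_norm hi (by
      refine Summable.of_nonneg_of_le (fun k => integral_nonneg fun w => norm_nonneg _)
        (fun k => ?_) ((hasSum_one_sub_rpow s (norm_nonneg y) hy1).summable.mul_right M)
      have := norm_integral_le_of_norm_le_const (μ := weightedMeasure d σ)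
        (f := fun w => ‖((c k : ℂ) * inner ℂ w y ^ k) * g w‖) (C := c k * ‖y‖ ^ k * M)
        (by simpa using hb k)
      simpa using (le_abs_self _).trans this)
    convert hsum using 1
    refine integral_congr_ae ?_
    filter_upwards [ae_weightedMeasure] with w hw
    exact ((hasSum_one_sub_cpow s
      ((norm_inner_le_of_mem hw y).trans_lt hy1)).mul_right (g w)).tsum_eq.symm

lemma analyticOnNhd_kernelIntegral (hd : 1 ≤ d) (hσ : -1 < σ) {s : ℝ} (hs : 0 < s)
    {g : Cd d → ℂ} {M : ℝ} (hg : AEStronglyMeasurable g (weightedMeasure d σ))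
    (hM : ∀ᵐ w ∂weightedMeasure d σ, ‖g w‖ ≤ M) :
    AnalyticOnNhd ℂ (kernelIntegral σ s g) (unitBall d) := by
  have h := (hasFPowerSeriesOnBall_kernelIntegral hd hσ hs hg hM).analyticOnNhd
  intro z hz
  apply h
  simpa [← ofReal_norm, enorm_eq_nnnorm] using hz

end BergmanBloch

/-! ### Seminorms on the coordinate space -/

namespace BergmanBloch

open Filter Topology Finset

section Seminorm

variable {ι : Type*} [Fintype ι] (N : Seminorm ℂ (ι → ℂ))

lemma exists_seminorm_le : ∃ A : ℝ, 0 ≤ A ∧ ∀ Z, N Z ≤ A * ‖Z‖ := by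
  classical
  refine ⟨∑ i, N (Pi.single i 1), sum_nonneg fun i _ => apply_nonneg N _, fun Z => ?_⟩
  have h : Z = ∑ i, Z i • (Pi.single i (1 : ℂ) : ι → ℂ) := by
    ext j
    simp [Finset.sum_apply, Pi.single_apply]
  calc N Z = N (∑ i, Z i • (Pi.single i (1 : ℂ) : ι → ℂ)) := by rw [← h]
    _ ≤ ∑ i, N (Z i • (Pi.single i (1 : ℂ) : ι → ℂ)) := 
      Finset.le_sum_of_subadditive N (map_zero N).le (map_add_le_add N) _ _
    _ ≤ ∑ i, N (Pi.single i (1 : ℂ)) * ‖Z‖ := by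
      refine sum_le_sum fun i _ => ?_
      rw [map_smul_eq_mul, mul_comm]
      exact mul_le_mul_of_nonneg_left (norm_le_pi_norm Z i) (apply_nonneg N _)
    _ = _ := by rw [sum_mul]

lemma continuous_seminorm : Continuous N := by
  obtain ⟨A, hA, h⟩ := exists_seminorm_le N
  refine (LipschitzWith.of_dist_le_mul (K := ⟨A, hA⟩) fun x y => ?_).continuous
  rw [dist_eq_norm, dist_eq_norm, Real.norm_eq_abs]
  exact (abs_sub_map_le_sub N x y).trans (h _)

/-- The triangle inequality for integrals, for a seminorm on a coordinate space. -/
lemma seminorm_integral_le {X : Type*} [MeasurableSpace X] {μ : Measure X} {V : X → ι → ℂ}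
    (hV : ∀ i, Integrable (fun x => V x i) μ) {b : X → ℝ} (hb : Integrable b μ)
    (h : ∀ᵐ x ∂μ, N (V x) ≤ b x) : N (fun i => ∫ x, V x i ∂μ) ≤ ∫ x, b x ∂μ := by
  set V₀ : ι → ℂ := fun i => ∫ x, V x i ∂μ
  by_cases h0 : V₀ = 0
  · rw [h0, map_zero]
    refine integral_nonneg_of_ae ?_
    filter_upwards [h] with x hx using (apply_nonneg N _).trans hx
  -- Hahn–Banach gives a real functional f ≤ N with f(V₀) = N(V₀). As f commutes with the integral,
  -- the inequality reduces to the pointwise one.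
  obtain ⟨f, hf1, hf2⟩ := exists_extension_of_le_sublinear
    (LinearPMap.mkSpanSingleton (K := ℝ) V₀ (N V₀) h0) N
    (fun c hc x => by
      rw [← Complex.coe_smul, map_smul_eq_mul, Complex.norm_real, Real.norm_of_nonneg hc.le])
    (fun x y => map_add_le_add N x y)
    (by
      rintro ⟨x, hx⟩
      obtain ⟨c, rfl⟩ := Submodule.mem_span_singleton.1 hx
      rw [LinearPMap.mkSpanSingleton'_apply]
      change c * N V₀ ≤ N (c • V₀)
      rw [← Complex.coe_smul, map_smul_eq_mul, Complex.norm_real]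
      exact mul_le_mul_of_nonneg_right (le_abs_self c) (apply_nonneg N _))
  have hf : f V₀ = N V₀ := by
    rw [← LinearPMap.mkSpanSingleton_apply ℝ ℝ h0 (N V₀)]
    exact hf1 ⟨V₀, Submodule.mem_span_singleton_self V₀⟩
  have hVi : Integrable V μ := Integrable.of_eval hV
  have hV0 : V₀ = ∫ x, V x ∂μ := by
    ext i; exact (eval_integral hV i).symm
  let F := LinearMap.toContinuousLinearMap f
  have hF : ∫ x, F (V x) ∂μ = F (∫ x, V x ∂μ) := F.integral_comp_comm hVi
  calc N V₀ = F (∫ x, V x ∂μ) := by rw [← hV0]; exact hf.symm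
    _ = ∫ x, F (V x) ∂μ := hF.symm
    _ ≤ ∫ x, b x ∂μ := by
      refine integral_mono_ae (F.integrable_comp hVi) hb ?_
      filter_upwards [h] with x hx using (hf2 (V x)).trans hx

end Seminorm

instance finite_multiIndex (d n : ℕ) : Finite (MultiIndex d n) := by
  refine Finite.of_injective (β := Fin d → Fin (n + 1)) (fun α j => ⟨α.1 j, ?_⟩) ?_
  · have := single_le_sum (f := α.1) (fun _ _ => Nat.zero_le _) (mem_univ j)
    have := α.2
    omega
  · intro α β h
    ext j
    simpa using congrArg Fin.val (congrFun h j)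

noncomputable instance fintype_multiIndex (d n : ℕ) : Fintype (MultiIndex d n) :=
  Fintype.ofFinite _

/-! ### The monomial vector: the maximum 𝓒 and Lipschitz bounds -/

section Monomials

variable {d n : ℕ}

lemma continuous_monomialVector : Continuous (monomialVector (d := d) n) := by
  unfold monomialVector
  fun_prop

lemma monomialVector_smul (c : ℂ) (ζ : Cd d) :
    monomialVector n (c • ζ) = c ^ n • monomialVector n ζ := by
  ext α
  simp only [monomialVector, PiLp.smul_apply, smul_eq_mul, mul_pow, prod_mul_distrib,
    prod_pow_eq_pow_sum, α.2, Pi.smul_apply]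

lemma norm_coord_le {w : Cd d} (hw : ‖w‖ ≤ 1) (j : Fin d) : ‖w j‖ ≤ 1 :=
  (PiLp.norm_apply_le w j).trans hw

lemma norm_monomialVector_le {w : Cd d} (hw : ‖w‖ ≤ 1) (α : MultiIndex d n) :
    ‖monomialVector n w α‖ ≤ 1 := by
  rw [monomialVector, norm_prod]
  refine prod_le_one (fun _ _ => norm_nonneg _) fun j _ => ?_
  rw [norm_pow]
  exact pow_le_one₀ (norm_nonneg _) (norm_coord_le hw j)

lemma norm_mul_sub_mul_le {a b a' b' : ℂ} (ha : ‖a‖ ≤ 1) (hb' : ‖b'‖ ≤ 1) :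
    ‖a * b - a' * b'‖ ≤ ‖a - a'‖ + ‖b - b'‖ := by
  have : a * b - a' * b' = a * (b - b') + (a - a') * b' := by ring
  rw [this]
  refine (norm_add_le _ _).trans ?_
  rw [norm_mul, norm_mul]
  nlinarith [norm_nonneg (a - a'), norm_nonneg (b - b')]

lemma norm_pow_sub_pow_le {a b : ℂ} (ha : ‖a‖ ≤ 1) (hb : ‖b‖ ≤ 1) (m : ℕ) :
    ‖a ^ m - b ^ m‖ ≤ m * ‖a - b‖ := by
  induction m with
  | zero => simp
  | succ m ih =>
    rw [pow_succ, pow_succ]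
    refine (norm_mul_sub_mul_le (by rw [norm_pow]; exact pow_le_one₀ (norm_nonneg _) ha) hb).trans ?_
    push_cast; linarith

lemma norm_prod_sub_prod_le {ι : Type*} (t : Finset ι) {f g : ι → ℂ} (hf : ∀ i, ‖f i‖ ≤ 1)
    (hg : ∀ i, ‖g i‖ ≤ 1) : ‖∏ i ∈ t, f i - ∏ i ∈ t, g i‖ ≤ ∑ i ∈ t, ‖f i - g i‖ := by
  classical
  induction t using Finset.induction_on with
  | empty => simp
  | insert i t hi ih =>
    rw [prod_insert hi, prod_insert hi, sum_insert hi]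
    refine (norm_mul_sub_mul_le (hf i) ?_).trans (by linarith)
    rw [norm_prod]
    exact prod_le_one (fun _ _ => norm_nonneg _) fun j _ => hg j

/-- Telescoping over the factors, all of modulus at most 1. The constant n is the sum of the
exponents α_j. -/
lemma norm_monomialVector_sub_le {w ζ : Cd d} (hw : ‖w‖ ≤ 1) (hζ : ‖ζ‖ ≤ 1)
    (α : MultiIndex d n) : ‖monomialVector n w α - monomialVector n ζ α‖ ≤ n * ‖w - ζ‖ := by
  have hpow : ∀ {v : Cd d}, ‖v‖ ≤ 1 → ∀ j, ‖v j ^ α.1 j‖ ≤ 1 := fun hv j => by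
    rw [norm_pow]; exact pow_le_one₀ (norm_nonneg _) (norm_coord_le hv j)
  refine (norm_prod_sub_prod_le univ (hpow hw) (hpow hζ)).trans ?_
  calc ∑ j, ‖w j ^ α.1 j - ζ j ^ α.1 j‖ ≤ ∑ j, (α.1 j : ℝ) * ‖w - ζ‖ := by
        refine sum_le_sum fun j _ =>
          (norm_pow_sub_pow_le (norm_coord_le hw j) (norm_coord_le hζ j) _).trans ?_
        gcongr
        exact PiLp.norm_apply_le (w - ζ) j
    _ = n * ‖w - ζ‖ := by
        rw [← sum_mul, ← Nat.cast_sum]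
        exact congrArg (fun m : ℕ => (m : ℝ) * ‖w - ζ‖) α.2

variable (N : Seminorm ℂ (MultiIndex d n → ℂ))

lemma isGreatest_extremalConst (hd : 1 ≤ d) :
    IsGreatest ((fun ζ : Cd d => N (monomialVector n ζ)) '' Metric.sphere 0 1)
      (extremalConst N) := by
  refine IsCompact.isGreatest_sSup ?_ ?_
  · exact (isCompact_sphere _ _).image ((continuous_seminorm N).comp continuous_monomialVector)
  · obtain ⟨ζ, hζ⟩ := exists_norm_eq_one hd
    exact ⟨_, ζ, by simpa using hζ, rfl⟩

lemma extremalConst_nonneg (hd : 1 ≤ d) : 0 ≤ extremalConst N := by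
  obtain ⟨ζ, _, h⟩ := (isGreatest_extremalConst N hd).1
  rw [← h]; exact apply_nonneg N _

lemma seminorm_monomialVector_le (hd : 1 ≤ d) {w : Cd d} (hw : ‖w‖ ≤ 1) :
    N (monomialVector n w) ≤ extremalConst N := by
  obtain ⟨ζ, hζ, hz⟩ := exists_eq_norm_smul hd w
  rw [hz, monomialVector_smul, map_smul_eq_mul, norm_pow, Complex.norm_real, norm_norm]
  have h1 : N (monomialVector n ζ) ≤ extremalConst N :=
    (isGreatest_extremalConst N hd).2 ⟨ζ, by simpa using hζ, rfl⟩
  have h2 : ‖w‖ ^ n ≤ 1 := pow_le_one₀ (norm_nonneg _) hw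
  exact (mul_le_of_le_one_left (apply_nonneg N _) h2).trans h1

end Monomials

/-- Since |w| ≤ 1 = |ζ|, expanding the square gives |w - ζ|² ≤ 2 Re(1 - ⟨ζ, w⟩). -/
lemma norm_sub_sq_le {d : ℕ} {w ζ : Cd d} (hw : ‖w‖ ≤ 1) (hζ : ‖ζ‖ = 1) :
    ‖w - ζ‖ ^ 2 ≤ 2 * ‖1 - inner ℂ w ζ‖ := by
  have h := norm_sub_sq (𝕜 := ℂ) w ζ
  have h2 := Complex.re_le_norm (1 - inner ℂ w ζ)
  simp only [Complex.sub_re, Complex.one_re] at h2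
  rw [h, hζ]
  change ‖w‖ ^ 2 - 2 * (inner ℂ w ζ).re + 1 ^ 2 ≤ _
  nlinarith [norm_nonneg w]

/-- Write 1 - u = (1 - ru) - (1 - r)u and use (1 - r)|u| ≤ 1 - r|u| ≤ |1 - ru|. -/
lemma norm_one_sub_le_two_mul {u : ℂ} (hu : ‖u‖ ≤ 1) {r : ℝ} (hr0 : 0 ≤ r) (hr : r ≤ 1) :
    ‖1 - u‖ ≤ 2 * ‖1 - r * u‖ := by
  have h1 : ‖1 - u‖ ≤ ‖1 - r * u‖ + (1 - r) * ‖u‖ := by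
    have : 1 - u = (1 - r * u) - ((1 - r : ℝ) : ℂ) * u := by push_cast; ring
    calc ‖1 - u‖ = ‖(1 - r * u) - ((1 - r : ℝ) : ℂ) * u‖ := by rw [← this]
      _ ≤ ‖1 - r * u‖ + ‖((1 - r : ℝ) : ℂ) * u‖ := norm_sub_le _ _
      _ = _ := by rw [norm_mul, Complex.norm_real, Real.norm_of_nonneg (by linarith)]
  have h2 : 1 - r * ‖u‖ ≤ ‖1 - r * u‖ := by
    have := norm_sub_norm_le (1 : ℂ) (r * u)
    rwa [norm_one, norm_mul, Complex.norm_real, Real.norm_of_nonneg hr0] at this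
  nlinarith [norm_nonneg u]

/-- This converts the distance from w to ζ into half a power of the kernel, uniformly in r, which is
the gain that makes the error in the lower bound negligible. -/
lemma norm_sub_le_kernel {d : ℕ} {w ζ : Cd d} (hw : ‖w‖ ≤ 1) (hζ : ‖ζ‖ = 1) {r : ℝ} (hr0 : 0 ≤ r)
    (hr : r ≤ 1) : ‖w - ζ‖ ≤ 2 * ‖1 - inner ℂ w ((r : ℂ) • ζ)‖ ^ (1 / 2 : ℝ) := by
  rw [← Real.sqrt_eq_rpow]
  have h1 := norm_sub_sq_le hw hζ
  have hu : ‖inner ℂ w ζ‖ ≤ 1 := by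
    refine (norm_inner_le_norm w ζ).trans ?_
    rw [hζ, mul_one]; exact hw
  have h2 := norm_one_sub_le_two_mul hu hr0 hr
  rw [inner_smul_right]
  refine (pow_le_pow_iff_left₀ (norm_nonneg _) (by positivity) two_ne_zero).1 ?_
  rw [mul_pow, Real.sq_sqrt (norm_nonneg _)]
  linarith

end BergmanBloch

/-! ### Bloch membership and the upper bound -/

namespace BergmanBloch

open Filter Topology Finset

variable {d : ℕ} {σ : ℝ}

lemma weight_exponent_pos (hσ : -1 < σ) : 0 < (d : ℝ) + 1 + σ := by
  have : (0 : ℝ) ≤ d := d.cast_nonneg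
  linarith

lemma one_sub_norm_sq_pos {z : Cd d} (hz : z ∈ unitBall d) : 0 < 1 - ‖z‖ ^ 2 := by
  have : ‖z‖ < 1 := mem_ball_zero_iff.1 hz
  nlinarith [norm_nonneg z]

lemma bergmanProj_eq_kernelIntegral (hd : 1 ≤ d) (hσ : -1 < σ) (G : Cd d → ℂ) :
    bergmanProj σ G = kernelIntegral σ (d + 1 + σ) G := by
  ext z
  rw [bergmanProj, kernelIntegral, integral_weightedMeasure hd hσ, Complex.real_smul]
  congr 2
  ext w
  rw [kernel, Complex.real_smul, Complex.cpow_neg]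
  ring

lemma integrable_kernel (hd : 1 ≤ d) (hσ : -1 < σ) {g : Cd d → ℂ} {M : ℝ}
    (hg : AEStronglyMeasurable g (weightedMeasure d σ))
    (hM : ∀ᵐ w ∂weightedMeasure d σ, ‖g w‖ ≤ M) {z : Cd d} (hz : z ∈ unitBall d) :
    Integrable (fun w => kernel σ z w * g w) (ballMeasure d) := by
  have h := (integrable_weightedMeasure_iff hd hσ _).1
    (integrable_kernel_mul hd hσ (weight_exponent_pos (d := d) hσ).le hg hM hz)
  refine h.congr (.of_forall fun w => ?_)
  simp only
  rw [kernel, Complex.real_smul, Complex.cpow_neg]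
  ring

lemma integrable_norm_kernel (hd : 1 ≤ d) (hσ : -1 < σ) {s : ℝ} (hs : 0 ≤ s) {z : Cd d}
    (hz : z ∈ unitBall d) :
    Integrable (fun w => ‖1 - inner ℂ w z‖ ^ (-s)) (weightedMeasure d σ) := by
  have h := (integrable_kernel_mul hd hσ hs (g := fun _ => 1) (M := 1) aestronglyMeasurable_const
    (by simp) hz).norm
  simpa only [mul_one, norm_kernel] using h

lemma norm_kernelIntegral_le (hd : 1 ≤ d) (hσ : -1 < σ) {s : ℝ} (hs : 0 < s) {g : Cd d → ℂ}
    {M : ℝ} (hM0 : 0 ≤ M) (hM : ∀ᵐ w ∂weightedMeasure d σ, ‖g w‖ ≤ M) {z : Cd d}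
    (hz : z ∈ unitBall d) :
    ‖kernelIntegral σ (d + 1 + σ + s) g z‖ ≤
      M * (gammaRatio (d + 1 + σ) s * (1 - ‖z‖ ^ 2) ^ (-s)) := by
  have hl := weight_exponent_pos (d := d) hσ
  refine (norm_integral_le_of_norm_le ((integrable_norm_kernel hd hσ
    (s := d + 1 + σ + s) (by positivity) hz).const_mul M) ?_).trans ?_
  · filter_upwards [hM] with w hw
    rw [norm_mul, norm_kernel, mul_comm]
    gcongr
  · rw [integral_const_mul]
    exact mul_le_mul_of_nonneg_left (integral_kernel_le hd hσ hz hs) hM0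

lemma kernelIntegral_mem_blochSpace (hd : 1 ≤ d) (hσ : -1 < σ) {g : Cd d → ℂ} {M : ℝ}
    (hM0 : 0 ≤ M) (hg : AEStronglyMeasurable g (weightedMeasure d σ))
    (hM : ∀ᵐ w ∂weightedMeasure d σ, ‖g w‖ ≤ M) :
    kernelIntegral σ (d + 1 + σ) g ∈ blochSpace d := by
  have hl := weight_exponent_pos (d := d) hσ
  refine ⟨analyticOnNhd_kernelIntegral hd hσ hl hg hM, ?_⟩
  -- The bound for a single partial derivative, from the kernel estimate with s = 1; the gradient is
  -- then bounded coordinatewise.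
  set K : ℝ := (d + 1 + σ) * (M * gammaRatio (d + 1 + σ) 1)
  refine ⟨√(∑ _j : Fin d, K ^ 2), fun z hz => ?_⟩
  have hz1 := one_sub_norm_sq_pos hz
  have hK : ∀ j, (1 - ‖z‖ ^ 2) * ‖partialDeriv j (kernelIntegral σ (d + 1 + σ) g) z‖ ≤ K := by
    intro j
    rw [partialDeriv_kernelIntegral hd hσ hl.le hg hM hz, norm_mul, Complex.norm_real,
      Real.norm_of_nonneg hl.le]
    have h1 := norm_kernelIntegral_le hd hσ one_pos hM0 (z := z)
      (g := fun w => starRingEnd ℂ (w j) * g w) (by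
        filter_upwards [ae_weightedMeasure, hM] with w hw hgw
        rw [norm_mul, RCLike.norm_conj]
        exact (mul_le_of_le_one_left (norm_nonneg _)
          (norm_coord_le (mem_ball_zero_iff.1 hw).le j)).trans hgw) hz
    rw [Real.rpow_neg_one] at h1
    calc _ ≤ (1 - ‖z‖ ^ 2) * ((d + 1 + σ) *
          (M * (gammaRatio (d + 1 + σ) 1 * (1 - ‖z‖ ^ 2)⁻¹))) := by gcongr
      _ = K := by simp only [K]; field_simp
  generalize 1 - ‖z‖ ^ 2 = a at hz1 hK ⊢
  rw [EuclideanSpace.norm_eq, ← Real.sqrt_sq hz1.le, ← Real.sqrt_mul (sq_nonneg _), mul_sum]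
  refine Real.sqrt_le_sqrt (sum_le_sum fun j _ => ?_)
  rw [← mul_pow]
  exact pow_le_pow_left₀ (by positivity) (hK j) 2

variable {n : ℕ}

lemma derivVector_kernelIntegral (hd : 1 ≤ d) (hσ : -1 < σ) {g : Cd d → ℂ} {M : ℝ}
    (hg : AEStronglyMeasurable g (weightedMeasure d σ))
    (hM : ∀ᵐ w ∂weightedMeasure d σ, ‖g w‖ ≤ M) {z : Cd d} (hz : z ∈ unitBall d) :
    derivVector n (kernelIntegral σ (d + 1 + σ) g) z = (rising (d + 1 + σ) n : ℂ) • fun α =>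
      ∫ w, (1 - inner ℂ w z) ^ (-((d + 1 + σ + n : ℝ) : ℂ)) *
        (starRingEnd ℂ (monomialVector n w α) * g w) ∂weightedMeasure d σ := by
  ext α
  exact mixedPartial_kernelIntegral hd hσ (weight_exponent_pos hσ).le hg hM hz α

variable (N : Seminorm ℂ (MultiIndex d n → ℂ))

lemma aestronglyMeasurable_conj_monomialVector (α : MultiIndex d n) :
    AEStronglyMeasurable (fun w => starRingEnd ℂ (monomialVector n w α)) (weightedMeasure d σ) :=
  (Complex.continuous_conj.comp
    ((continuous_apply α).comp continuous_monomialVector)).aestronglyMeasurable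

lemma seminorm_derivVector_le (hd : 1 ≤ d) (hn : 1 ≤ n) (hσ : -1 < σ)
    (hconj : ∀ Z, N (fun α => starRingEnd ℂ (Z α)) = N Z) {g : Cd d → ℂ} {M : ℝ} (hM0 : 0 ≤ M)
    (hg : AEStronglyMeasurable g (weightedMeasure d σ))
    (hM : ∀ᵐ w ∂weightedMeasure d σ, ‖g w‖ ≤ M) {z : Cd d} (hz : z ∈ unitBall d) :
    (1 - ‖z‖ ^ 2) ^ n * N (derivVector n (kernelIntegral σ (d + 1 + σ) g) z) ≤
      extremalConst N * (rising (d + 1 + σ) n * gammaRatio (d + 1 + σ) n) * M := by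
  have hl := weight_exponent_pos (d := d) hσ
  have hn0 : (0 : ℝ) < n := by exact_mod_cast hn
  have hz1 := one_sub_norm_sq_pos hz
  have hr := rising_pos hl n
  have hC := extremalConst_nonneg N hd
  rw [derivVector_kernelIntegral hd hσ hg hM hz, map_smul_eq_mul, Complex.norm_real,
    Real.norm_of_nonneg hr.le]
  have h1 := seminorm_integral_le N (μ := weightedMeasure d σ)
    (V := fun w α => (1 - inner ℂ w z) ^ (-((d + 1 + σ + n : ℝ) : ℂ)) *
        (starRingEnd ℂ (monomialVector n w α) * g w))
    (b := fun w => (extremalConst N * M) * ‖1 - inner ℂ w z‖ ^ (-(d + 1 + σ + n)))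
    (fun α => integrable_kernel_mul hd hσ (by positivity) (M := M)
      ((aestronglyMeasurable_conj_monomialVector α).mul hg) (by
        filter_upwards [ae_weightedMeasure, hM] with w hw hgw
        rw [Pi.mul_apply, norm_mul, RCLike.norm_conj]
        exact (mul_le_of_le_one_left (norm_nonneg _)
          (norm_monomialVector_le (mem_ball_zero_iff.1 hw).le α)).trans hgw) hz)
    ((integrable_norm_kernel hd hσ (by positivity) hz).const_mul _)
    (by
      filter_upwards [ae_weightedMeasure, hM] with w hw hgw
      have : (fun α => (1 - inner ℂ w z) ^ (-((d + 1 + σ + n : ℝ) : ℂ)) *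
          (starRingEnd ℂ (monomialVector n w α) * g w)) =
          ((1 - inner ℂ w z) ^ (-((d + 1 + σ + n : ℝ) : ℂ)) * g w) •
            (fun α => starRingEnd ℂ (monomialVector n w α)) := by
        ext α; simp only [Pi.smul_apply, smul_eq_mul]; ring
      rw [this, map_smul_eq_mul, hconj, norm_mul, norm_kernel]
      have h2 := seminorm_monomialVector_le N hd (mem_ball_zero_iff.1 hw).le
      calc _ ≤ ‖1 - inner ℂ w z‖ ^ (-(d + 1 + σ + n)) * M * extremalConst N := by
            gcongr
        _ = _ := by ring)
  rw [integral_const_mul] at h1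
  have h3 := integral_kernel_le hd hσ hz hn0
  have h4 : (1 - ‖z‖ ^ 2) ^ n * (1 - ‖z‖ ^ 2) ^ (-(n : ℝ)) = 1 := by
    rw [← Real.rpow_natCast, ← Real.rpow_add hz1]; simp
  calc _ ≤ (1 - ‖z‖ ^ 2) ^ n * (rising (d + 1 + σ) n * ((extremalConst N * M) *
        (gammaRatio (d + 1 + σ) n * (1 - ‖z‖ ^ 2) ^ (-(n : ℝ))))) := by
        gcongr
        exact h1.trans (by gcongr)
    _ = extremalConst N * (rising (d + 1 + σ) n * gammaRatio (d + 1 + σ) n) * M *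
        ((1 - ‖z‖ ^ 2) ^ n * (1 - ‖z‖ ^ 2) ^ (-(n : ℝ))) := by ring
    _ = _ := by rw [h4, mul_one]

/-! ### Extremal functions and the lower bound -/

/-- The unimodular function that makes the kernel of exponent `-s` at `z` positive. -/
noncomputable def phase (s : ℝ) (z w : Cd d) : ℂ :=
  (‖(1 - inner ℂ w z) ^ (-(s : ℂ))‖ : ℂ) / (1 - inner ℂ w z) ^ (-(s : ℂ))

lemma norm_phase_le (s : ℝ) (z w : Cd d) : ‖phase s z w‖ ≤ 1 := by
  rw [phase, norm_div, Complex.norm_real, norm_norm]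
  exact div_self_le_one _

lemma measurable_phase (s : ℝ) (z : Cd d) : Measurable (phase s z) := by
  have := measurable_cpow_kernel z (-(s : ℂ))
  unfold phase
  fun_prop

lemma kernel_mul_phase (s : ℝ) (z w : Cd d) :
    (1 - inner ℂ w z) ^ (-(s : ℂ)) * phase s z w = (‖1 - inner ℂ w z‖ ^ (-s) : ℝ) := by
  rw [phase, norm_kernel]
  -- No point is excluded: where the kernel vanishes, both sides are 0.
  by_cases h : (1 - inner ℂ w z) ^ (-(s : ℂ)) = 0
  · rw [← norm_kernel, h]; simp
  · field_simp

/-- With this phase the integrand is a positive kernel times conj Z(w). Freezing Z(w) at Z(ζ) gives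
the main term, and the reverse triangle inequality bounds the loss by a kernel integral whose
exponent is lower by 1/2. `A` does not depend on ζ or r. -/
lemma seminorm_derivVector_phase_ge (hd : 1 ≤ d) (hn : 1 ≤ n) (hσ : -1 < σ)
    (hconj : ∀ Z, N (fun α => starRingEnd ℂ (Z α)) = N Z) :
    ∃ A : ℝ, 0 ≤ A ∧ ∀ ζ : Cd d, ‖ζ‖ = 1 → ∀ r : ℝ, 0 ≤ r → r < 1 →
      rising (d + 1 + σ) n * (N (monomialVector n ζ) *
        ∫ w, ‖1 - inner ℂ w ((r : ℂ) • ζ)‖ ^ (-(d + 1 + σ + n)) ∂weightedMeasure d σ -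
        A * ∫ w, ‖1 - inner ℂ w ((r : ℂ) • ζ)‖ ^ (-(d + 1 + σ + (n - 1 / 2)))
          ∂weightedMeasure d σ) ≤
      N (derivVector n (kernelIntegral σ (d + 1 + σ)
        (phase (d + 1 + σ + n) ((r : ℂ) • ζ))) ((r : ℂ) • ζ)) := by
  have hl := weight_exponent_pos (d := d) hσ
  have hn1 : (1 : ℝ) ≤ n := by exact_mod_cast hn
  have hr' := rising_pos hl n
  obtain ⟨A, hA, hN⟩ := exists_seminorm_le N
  refine ⟨A * (n * 2), by positivity, fun ζ hζ r hr0 hr => ?_⟩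
  set z : Cd d := (r : ℂ) • ζ
  have hz : z ∈ unitBall d := by
    rw [mem_ball_zero_iff, norm_smul, hζ, mul_one, Complex.norm_real, Real.norm_of_nonneg hr0]
    exact hr
  set κ : Cd d → ℝ := fun w => ‖1 - inner ℂ w z‖ ^ (-(d + 1 + σ + n))
  have hκi : Integrable κ (weightedMeasure d σ) := integrable_norm_kernel hd hσ (by positivity) hz
  have hκ0 : ∀ w, 0 ≤ κ w := fun w => Real.rpow_nonneg (norm_nonneg _) _
  rw [derivVector_kernelIntegral hd hσ (measurable_phase _ z).aestronglyMeasurable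
    (.of_forall (norm_phase_le _ z)) hz, map_smul_eq_mul, Complex.norm_real,
    Real.norm_of_nonneg hr'.le]
  refine mul_le_mul_of_nonneg_left ?_ hr'.le
  have hV : ∀ α : MultiIndex d n, Integrable (fun w => (κ w : ℂ) *
      starRingEnd ℂ (monomialVector n w α)) (weightedMeasure d σ) := fun α =>
    hκi.ofReal.mul_bdd (c := 1) (aestronglyMeasurable_conj_monomialVector α) (by
      filter_upwards [ae_weightedMeasure] with w hw
      rw [RCLike.norm_conj]
      exact norm_monomialVector_le (mem_ball_zero_iff.1 hw).le α)
  have hV' : ∀ α : MultiIndex d n, Integrable (fun w => (κ w : ℂ) *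
      starRingEnd ℂ (monomialVector n ζ α)) (weightedMeasure d σ) := fun α =>
    hκi.ofReal.mul_const _
  set V₀ : MultiIndex d n → ℂ := fun α => ∫ w, (κ w : ℂ) *
      starRingEnd ℂ (monomialVector n w α) ∂weightedMeasure d σ
  have hV0 : (fun α => ∫ w, (1 - inner ℂ w z) ^ (-((d + 1 + σ + n : ℝ) : ℂ)) *
        (starRingEnd ℂ (monomialVector n w α) * phase (d + 1 + σ + n) z w)
          ∂weightedMeasure d σ) = V₀ := by
    ext α
    refine integral_congr_ae (.of_forall fun w => ?_)
    simp only
    rw [mul_left_comm, kernel_mul_phase, mul_comm]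
  rw [hV0]
  set E : MultiIndex d n → ℂ := fun α => ∫ w, ((κ w : ℂ) *
      starRingEnd ℂ (monomialVector n ζ α) - (κ w : ℂ) * starRingEnd ℂ (monomialVector n w α))
        ∂weightedMeasure d σ
  -- `E` is the error of freezing the monomial vector at ζ.
  have hsum : ((∫ w, κ w ∂weightedMeasure d σ : ℝ) : ℂ) •
      (fun α => starRingEnd ℂ (monomialVector n ζ α)) = V₀ + E := by
    ext α
    simp only [Pi.smul_apply, Pi.add_apply, smul_eq_mul, E, V₀]
    rw [integral_sub (hV' α) (hV α), integral_mul_const, integral_complex_ofReal]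
    ring
  have h1 := map_add_le_add N V₀ E
  rw [← hsum, map_smul_eq_mul, hconj, Complex.norm_real,
    Real.norm_of_nonneg (integral_nonneg hκ0)] at h1
  have h2 : N E ≤ ∫ w, A * (n * 2) * ‖1 - inner ℂ w z‖ ^ (-(d + 1 + σ + (n - 1 / 2)))
      ∂weightedMeasure d σ := by
    refine seminorm_integral_le N (fun α => (hV' α).sub (hV α))
      ((integrable_norm_kernel hd hσ (by linarith) hz).const_mul _) ?_
    filter_upwards [ae_weightedMeasure] with w hw
    have hw1 : ‖w‖ ≤ 1 := (mem_ball_zero_iff.1 hw).le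
    have hpos : 0 < ‖1 - inner ℂ w z‖ :=
      (sub_pos.2 (mem_ball_zero_iff.1 hz)).trans_le (one_sub_norm_le hw)
    have h3 : (fun α => (κ w : ℂ) * starRingEnd ℂ (monomialVector n ζ α) -
        (κ w : ℂ) * starRingEnd ℂ (monomialVector n w α)) = (κ w : ℂ) • fun α =>
          starRingEnd ℂ ((monomialVector n ζ - monomialVector n w) α) := by
      ext α; simp only [Pi.smul_apply, Pi.sub_apply, smul_eq_mul, map_sub]; ring
    refine (congrArg N h3).trans_le ?_
    rw [map_smul_eq_mul, hconj, Complex.norm_real, Real.norm_of_nonneg (hκ0 w)]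
    have h4 : ‖monomialVector n ζ - monomialVector n w‖ ≤
        n * (2 * ‖1 - inner ℂ w z‖ ^ (1 / 2 : ℝ)) := by
      refine (pi_norm_le_iff_of_nonneg (by positivity)).2 fun α => ?_
      rw [Pi.sub_apply, norm_sub_rev]
      refine (norm_monomialVector_sub_le hw1 hζ.le α).trans ?_
      gcongr
      exact norm_sub_le_kernel hw1 hζ hr0 hr.le
    have h5 : ‖1 - inner ℂ w z‖ ^ (-(d + 1 + σ + (n - 1 / 2))) =
        κ w * ‖1 - inner ℂ w z‖ ^ (1 / 2 : ℝ) := by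
      rw [← Real.rpow_add hpos]; congr 1; ring
    have h6 := hκ0 w
    calc _ ≤ κ w * (A * (n * (2 * ‖1 - inner ℂ w z‖ ^ (1 / 2 : ℝ)))) := by
          gcongr
          exact (hN _).trans (by gcongr)
      _ = _ := by rw [h5]; ring
  rw [integral_const_mul] at h2
  rw [mul_comm (N _)]
  linarith

lemma ae_norm_le_Lp_norm {X : Type*} [MeasurableSpace X] {μ : Measure X} (G : Lp ℂ ∞ μ) :
    ∀ᵐ w ∂μ, ‖G w‖ ≤ ‖G‖ := by
  have h := ae_le_eLpNormEssSup (f := G) (μ := μ)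
  filter_upwards [h] with w hw
  rw [Lp.norm_def, eLpNorm_exponent_top, ← toReal_enorm]
  refine ENNReal.toReal_mono ?_ hw
  rw [← eLpNorm_exponent_top]
  exact Lp.eLpNorm_ne_top G

lemma ae_weightedMeasure_norm_le (G : Lp ℂ ∞ (ballMeasure d)) :
    ∀ᵐ w ∂weightedMeasure d σ, ‖G w‖ ≤ ‖G‖ :=
  weightedMeasure_absolutelyContinuous.ae_le (ae_norm_le_Lp_norm G)

lemma aestronglyMeasurable_Lp (G : Lp ℂ ∞ (ballMeasure d)) :
    AEStronglyMeasurable G (weightedMeasure d σ) :=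
  (Lp.aestronglyMeasurable G).mono_ac weightedMeasure_absolutelyContinuous

lemma blochSeminorm_bergmanProj_le (hd : 1 ≤ d) (hn : 1 ≤ n) (hσ : -1 < σ)
    (hconj : ∀ Z, N (fun α => starRingEnd ℂ (Z α)) = N Z) (G : Lp ℂ ∞ (ballMeasure d)) :
    blochSeminorm N (bergmanProj σ G) ≤ ENNReal.ofReal (extremalConst N *
      (rising (d + 1 + σ) n * gammaRatio (d + 1 + σ) n)) * ‖G‖ₑ := by
  rw [bergmanProj_eq_kernelIntegral hd hσ, ← ofReal_norm,
    ← ENNReal.ofReal_mul' (norm_nonneg _)]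
  refine iSup₂_le fun z hz => ENNReal.ofReal_le_ofReal ?_
  exact seminorm_derivVector_le N hd hn hσ hconj (norm_nonneg G) (aestronglyMeasurable_Lp G)
    (ae_weightedMeasure_norm_le G) hz

lemma exists_Lp_of_norm_le_one {g : Cd d → ℂ} (hg : Measurable g) (h1 : ∀ w, ‖g w‖ ≤ 1) :
    ∃ G : Lp ℂ ∞ (ballMeasure d), ‖G‖ ≤ 1 ∧ ∀ σ s, kernelIntegral σ s G = kernelIntegral σ s g := by
  have hm : MemLp g ∞ (ballMeasure d) :=
    memLp_top_of_bound hg.aestronglyMeasurable 1 (.of_forall h1)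
  refine ⟨hm.toLp g, ?_, fun σ s => ?_⟩
  · rw [Lp.norm_toLp, eLpNorm_exponent_top]
    refine ENNReal.toReal_le_of_le_ofReal zero_le_one ?_
    exact eLpNormEssSup_le_of_ae_bound (.of_forall h1)
  · ext z
    refine integral_congr_ae ?_
    filter_upwards [weightedMeasure_absolutelyContinuous.ae_le hm.coeFn_toLp] with w hw
    rw [hw]

lemma le_iSup_blochSeminorm (hd : 1 ≤ d) (hn : 1 ≤ n) (hσ : -1 < σ)
    (hconj : ∀ Z, N (fun α => starRingEnd ℂ (Z α)) = N Z) :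
    ENNReal.ofReal (extremalConst N * (rising (d + 1 + σ) n * gammaRatio (d + 1 + σ) n)) ≤
      ⨆ G : {G : Lp ℂ ∞ (ballMeasure d) // ‖G‖ ≤ 1}, blochSeminorm N (bergmanProj σ G.1) := by
  have hl := weight_exponent_pos (d := d) hσ
  have hn1 : (1 : ℝ) ≤ n := by exact_mod_cast hn
  obtain ⟨A, hA, hlow⟩ := seminorm_derivVector_phase_ge N hd hn hσ hconj
  obtain ⟨ζ, hζ, hζC⟩ := (isGreatest_extremalConst N hd).1
  replace hζ : ‖ζ‖ = 1 := by simpa using hζ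
  replace hζC : N (monomialVector n ζ) = extremalConst N := hζC
  have t1 := tendsto_integral_kernel hd hσ hζ (s := n) (by linarith)
  have t2 := tendsto_integral_kernel hd hσ hζ (s := n - 1 / 2) (by linarith)
  have t3 : Tendsto (fun r : ℝ => (1 - r ^ 2) ^ (1 / 2 : ℝ)) (𝓝[<] 1) (𝓝 0) := by
    have : ContinuousAt (fun r : ℝ => (1 - r ^ 2) ^ (1 / 2 : ℝ)) 1 :=
      (by fun_prop : ContinuousAt (fun r : ℝ => 1 - r ^ 2) 1).rpow_const (Or.inr (by norm_num))
    have h := this.tendsto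
    simp only [one_pow, sub_self, Real.zero_rpow (show (1 / 2 : ℝ) ≠ 0 by norm_num)] at h
    exact h.mono_left nhdsWithin_le_nhds
  -- The weight (1 - r²)^n splits as (1 - r²)^(1/2) (1 - r²)^(n-1/2): the second factor keeps the
  -- error integral bounded and the first sends it to 0.
  have t4 := ((t1.const_mul (extremalConst N)).sub
    ((t3.mul t2).const_mul A)).const_mul (rising (d + 1 + σ) n)
  rw [zero_mul, mul_zero, sub_zero, mul_left_comm] at t4
  refine le_of_tendsto ((ENNReal.continuous_ofReal.tendsto _).comp t4) ?_
  filter_upwards [Ico_mem_nhdsLT (show (0 : ℝ) < 1 by norm_num)] with r hr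
  have hrz : ‖(r : ℂ) • ζ‖ = r := by
    rw [norm_smul, hζ, mul_one, Complex.norm_real, Real.norm_of_nonneg hr.1]
  have hz : (r : ℂ) • ζ ∈ unitBall d := by
    rw [mem_ball_zero_iff, hrz]; exact hr.2
  have hr1 : 0 < 1 - r ^ 2 := by have := one_sub_norm_sq_pos hz; rwa [hrz] at this
  obtain ⟨G, hG, hGk⟩ := exists_Lp_of_norm_le_one (measurable_phase (d + 1 + σ + n) ((r : ℂ) • ζ))
    (norm_phase_le _ _)
  refine le_trans ?_ (le_iSup (fun G : {G : Lp ℂ ∞ (ballMeasure d) // ‖G‖ ≤ 1} =>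
    blochSeminorm N (bergmanProj σ G.1)) ⟨G, hG⟩)
  refine le_trans ?_ (le_iSup₂ ((r : ℂ) • ζ) hz)
  refine ENNReal.ofReal_le_ofReal ?_
  rw [bergmanProj_eq_kernelIntegral hd hσ, hGk, hrz]
  have h := mul_le_mul_of_nonneg_left (hlow ζ hζ r hr.1 hr.2) (pow_nonneg hr1.le n)
  refine le_trans (le_of_eq ?_) h
  have e1 : (1 - r ^ 2) ^ (1 / 2 : ℝ) * (1 - r ^ 2) ^ ((n : ℝ) - 1 / 2) = (1 - r ^ 2) ^ n := by
    rw [← Real.rpow_add hr1, ← Real.rpow_natCast _ n]; congr 1; ring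
  beta_reduce
  rw [hζC, ← mul_assoc ((1 - r ^ 2) ^ (1 / 2 : ℝ)), e1, Real.rpow_natCast]
  ring

lemma rising_mul_gammaRatio (hσ : -1 < σ) :
    rising (d + 1 + σ) n * gammaRatio (d + 1 + σ) n =
      Real.Gamma (((d : ℝ) + 1 + σ) + n) * Real.Gamma n /
          Real.Gamma ((((d : ℝ) + 1 + σ) + n) / 2) ^ 2 := by
  rw [Gamma_add_nat (weight_exponent_pos hσ), gammaRatio]
  ring

end BergmanBloch

/-! ### The norm formula -/

open BergmanBloch
theorem mainTheorem1 (d n : ℕ) (hd : 1 ≤ d) (hn : 1 ≤ n) (σ : ℝ) (hσ : -1 < σ)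
    (N : Seminorm ℂ (MultiIndex d n → ℂ)) (hN : ∀ Z, N Z = 0 → Z = 0)
    (hconj : ∀ Z, N (fun α => starRingEnd ℂ (Z α)) = N Z) :
    -- `T_σ` is well defined on `L^∞(B)` and takes its values in the Bloch space
    (∀ G : Lp ℂ ∞ (ballMeasure d),
      (∀ z ∈ unitBall d, Integrable (fun w => kernel σ z w * G w) (ballMeasure d)) ∧
      bergmanProj σ G ∈ blochSpace d) ∧
    -- `𝓒` is a maximum
    IsGreatest ((fun ζ : Cd d => N (monomialVector n ζ)) '' Metric.sphere 0 1)
      (extremalConst N) ∧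
    -- the operator norm, as the supremum over the unit ball of `L^∞(B)`, and its value
    bergmanOpNorm σ N =
      ⨆ G : {G : Lp ℂ ∞ (ballMeasure d) // ‖G‖ ≤ 1}, blochSeminorm N (bergmanProj σ G.1) ∧
    (⨆ G : {G : Lp ℂ ∞ (ballMeasure d) // ‖G‖ ≤ 1}, blochSeminorm N (bergmanProj σ G.1)) =
      ENNReal.ofReal (extremalConst N *
        (Real.Gamma (((d : ℝ) + 1 + σ) + n) * Real.Gamma n /
          Real.Gamma ((((d : ℝ) + 1 + σ) + n) / 2) ^ 2)) := by
  rw [← rising_mul_gammaRatio hσ]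
  have hge := le_iSup_blochSeminorm N hd hn hσ hconj
  have hball : ∀ (M : ℝ≥0∞), (∀ G : Lp ℂ ∞ (ballMeasure d),
      blochSeminorm N (bergmanProj σ G) ≤ M * ‖G‖ₑ) →
      ⨆ G : {G : Lp ℂ ∞ (ballMeasure d) // ‖G‖ ≤ 1}, blochSeminorm N (bergmanProj σ G.1) ≤ M := by
    refine fun M hM => iSup_le fun G => (hM G.1).trans (mul_le_of_le_one_right' ?_)
    rw [← ofReal_norm]
    exact ENNReal.ofReal_le_one.2 G.2
  have hle := blochSeminorm_bergmanProj_le N hd hn hσ hconj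
  have heq := le_antisymm (hball _ hle) hge
  refine ⟨fun G => ⟨fun z hz => integrable_kernel hd hσ (aestronglyMeasurable_Lp G)
    (ae_weightedMeasure_norm_le G) hz, ?_⟩, isGreatest_extremalConst N hd, ?_, heq⟩
  · rw [bergmanProj_eq_kernelIntegral hd hσ]
    exact kernelIntegral_mem_blochSpace hd hσ (norm_nonneg G) (aestronglyMeasurable_Lp G)
      (ae_weightedMeasure_norm_le G)
  -- Every admissible M dominates the supremum over the unit ball, and by `heq` the supremum equals
  -- the constant shown admissible in `hle`.
  · refine le_antisymm ?_ (le_sInf fun M hM => hball M hM)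
    rw [heq]
    exact sInf_le hle
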